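/- Let $G$ be a finite group. For $x=\sum_g n_g g\in\mathbb ZG$ write $\overline x=\sum_g n_g$, and apply $x\mapsto\overline x$ coefficientwise and entrywise to polynomials and matrices over $\mathbb ZG$ and $\mathbb ZG[t]$. A square matrix $A$ over $\mathbb ZG$ is *$G$-primitive* if its entries lie in $\mathbb Z_+G$ and, for some $p>0$, every coefficient $n_g$ of every entry of $A^p$ is positive; $\lambda_A$ denotes the spectral radius of the integer matrix $\overline A$. For a square matrix $B=\sum_{i=1}^{d}B_it^i$ over $t\,\mathbb ZG[t]$, where the $B_i$ are matrices over $\mathbb ZG$ and $d\ge 1$ is the largest degree of an entry, $B^{\Box}$ is the $d\times d$ block matrix over $\mathbb ZG$ with top block row $(B_1,\dots,B_d)$, identity blocks just below the diagonal, and zero blocks elsewhere. Square matrices $M,N$ of the same size over a ring $R$ are *$\mathrm{El}(R)$-equivalent* if $U(M\oplus I_j)V=N\oplus I_j$ for some $j$ and some products $U,V$ of basic elementary matrices over $R$ (matrices that differ from the identity in at most one off-diagonal entry). *Strong shift equivalence (SSE) over $\mathbb Z_+$* is the transitive relation on square matrices over $\mathbb Z_+$ generated by the pairs $(RS,SR)$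 with $R,S$ rectangular matrices over $\mathbb Z_+$. **Proposition 5.4.** Let $A$ be an $n\times n$ $G$-primitive matrix over $\mathbb Z_+G$ with $n>1$, let $1<\beta<\lambda_A$, and let $k\ge 0$ be an integer. Then there is a positive integer $r_0$ (depending on $A$, $\beta$ and $k$) such that the following holds. If $r\ge r_0$ and $Q$ is a $k\times k$ matrix over $\mathbb ZG[t]$ such that $I-Q\in \mathrm{GL}(k,\mathbb ZG[t])$ and (i) $|q_{ijsg}|\le\beta^s$ for all $i,j,s,g$, where $q_{ijsg}\in\mathbb Z$ is the coefficient of $g\,t^s$ in the $(i,j)$ entry of $Q$, and (ii) all entries of $Q$ lie in $t^r\,\mathbb ZG[t]$, then the matrix $\begin{pmatrix} I-Q&0\\0&I-tA\end{pmatrix}$ is $\mathrm{El}(\mathbb ZG[t])$-equivalent to a matrix $I-B$, where $B$ is an $(n+k)\times(n+k)$ matrix over $\mathbb ZG[t]$ such that (1) $B$ has all entries in $t\,\mathbb Z_+G[t]$, (2) $B^{\Box}$ is $G$-primitive, and (3) if $\overline Q=0$, then $\overline{B^{\Box}}$ is SSE over $\mathbb Z_+$ to $\overline A$. -/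

import Mathlib

open Polynomial

noncomputable section

namespace GExt

/-- The integral group ring `ℤG`. -/
abbrev ZG (G : Type*) : Type _ := MonoidAlgebra ℤ G

section Group

variable {G : Type*} [Group G]

/-- The augmentation `ℤG → ℤ`, `∑ n_g g ↦ ∑ n_g`. -/
def aug : ZG G →+* ℤ :=
  (MonoidAlgebra.lift ℤ ℤ G (1 : G →* ℤ)).toRingHom

theorem aug_apply (x : ZG G) : aug x = x.coeff.sum fun _ c => c := by
  simp [aug, MonoidAlgebra.lift_apply]

/-- The augmentation `ℤG[t] → ℤ[t]`, applied to each coefficient. -/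
def augPoly : (ZG G)[X] →+* ℤ[X] := Polynomial.mapRingHom aug

/-- `x ∈ ℤ₊G`: all integer coefficients are nonnegative. -/
def Nonneg (x : ZG G) : Prop := ∀ g, 0 ≤ x.coeff g

/-- `x ≫ 0`: the coefficient of every group element is positive. -/
def StrictlyPos (x : ZG G) : Prop := ∀ g, 0 < x.coeff g

/-- A square matrix over `ℤG` is `G`-primitive if its entries are in `ℤ₊G` and some positive
power has all entries `≫ 0`. -/
def GPrimitive {m : Type*} [Fintype m] [DecidableEq m] (A : Matrix m m (ZG G)) : Prop :=
  (∀ i j, Nonneg (A i j)) ∧ ∃ p : ℕ, 0 < p ∧ ∀ i j, StrictlyPos ((A ^ p) i j)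

/-- The spectral radius `λ_A` of a square matrix over `ℤG`: the largest modulus of a complex
eigenvalue of the integer matrix obtained by augmenting the entries. -/
def specRadius {m : Type*} [Fintype m] [DecidableEq m] (A : Matrix m m (ZG G)) : ℝ :=
  (spectralRadius ℂ (A.map fun x => ((aug x : ℤ) : ℂ))).toReal

/-- The entries of the matrix lie in `t ℤ₊G[t]`. -/
def OverTPos {m : Type*} (B : Matrix m m (ZG G)[X]) : Prop :=
  ∀ i j, (B i j).coeff 0 = 0 ∧ ∀ s, Nonneg ((B i j).coeff s)

end Group

section Ring

variable {R : Type*} [Ring R]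

/-- The matrix `tA` over `R[t]` of a matrix `A` over `R`. -/
def tMul {m : Type*} (A : Matrix m m R) : Matrix m m R[X] :=
  A.map (Polynomial.monomial 1)

/-- The largest degree of an entry of a polynomial matrix (and `1` if there is no entry of
positive degree). -/
def polyDegree {m : Type*} [Fintype m] (A : Matrix m m R[X]) : ℕ :=
  max 1 (Finset.univ.sup fun i => Finset.univ.sup fun j => (A i j).natDegree)

/-- The matrix `A^□` over `R` of a square matrix `A = A₁ t + ⋯ + A_d t^d` over `t R[t]`, `d` being
the largest degree of an entry: the `d × d` block matrix with top block row `A₁, …, A_d`, with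
identity blocks just below the diagonal, and with all other blocks zero. An index `(a, i)` stands
for the position `i` in the block number `a + 1`. -/
def box {m : Type*} [Fintype m] [DecidableEq m] (A : Matrix m m R[X]) :
    Matrix (Fin (polyDegree A) × m) (Fin (polyDegree A) × m) R :=
  Matrix.of fun x y =>
    if (x.1 : ℕ) = 0 then (A x.2 y.2).coeff ((y.1 : ℕ) + 1)
    else if (x.1 : ℕ) = (y.1 : ℕ) + 1 ∧ x.2 = y.2 then 1 else 0

/-- The products of basic elementary matrices `1 + r E_{ij}`, `i ≠ j`. This is closed under
inverses, as `1 + r E_{ij}` has the inverse `1 + (-r) E_{ij}`. -/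
def El (m : Type*) [Fintype m] [DecidableEq m] (R : Type*) [Ring R] : Submonoid (Matrix m m R) :=
  Submonoid.closure {U | ∃ i j : m, i ≠ j ∧ ∃ r : R, U = 1 + Matrix.single i j r}

/-- `El(R)` equivalence of two square matrices `M`, `N` of the same size:
`U (M ⊕ I_j) V = N ⊕ I_j` for some `j` and some products `U`, `V` of basic elementary matrices. -/
def ElEquiv {m : Type*} [Fintype m] [DecidableEq m] (M N : Matrix m m R) : Prop :=
  ∃ j : ℕ, ∃ U ∈ El (m ⊕ Fin j) R, ∃ V ∈ El (m ⊕ Fin j) R,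
    U * Matrix.fromBlocks M 0 0 1 * V = Matrix.fromBlocks N 0 0 1

/-- Strong shift equivalence over a set `S` of scalars: the transitive relation, between square
matrices of possibly different sizes, generated by the pairs `(U V, V U)` with `U`, `V`
(rectangular) matrices over `S`. -/
inductive SSE (S : Set R) :
    ∀ {m n : Type} [Fintype m] [Fintype n], Matrix m m R → Matrix n n R → Prop
  | elementary {m n : Type} [Fintype m] [Fintype n] (U : Matrix m n R) (V : Matrix n m R)
      (hU : ∀ i j, U i j ∈ S) (hV : ∀ i j, V i j ∈ S) : SSE S (U * V) (V * U)
  | trans {l m n : Type} [Fintype l] [Fintype m] [Fintype n]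
      {A : Matrix l l R} {B : Matrix m m R} {C : Matrix n n R} :
      SSE S A B → SSE S B C → SSE S A C

end Ring

end GExt

end

/-!
Regard a matrix over `tℤ₊G[t]` as a weighted graph whose edges have lengths. Fix a vertex `i₀` of
`A` and replace the edges leaving it by first-passage paths of bounded length, which is an
elementary operation on `I - tA`. For each new vertex `a`, split off a loop
`z a = g a * t ^ (s a + 1)` at `i₀`, with distinct lengths, so that `I - tA` becomes
`I - (S * Z + C)`, where `S * Z` collects these loops and `C` still has entries in `tℤ₊G[t]`.
Together with `I - Q` this is equivalent to the block matrix with diagonal blocks `I - Q`, `I - C`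
and off-diagonal blocks `-(I - Q) * Z`, `-S`: the loops now pass through the new vertices, which
they leave along the edges to `i₀` of weights `y = (I - Q) * z`.

These weights may have negative coefficients, but `y * (I - C)⁻¹` does not: with `β < γ < λ_A`, the
weights of the paths from `i₀` grow at least like `γ ^ m`, and so dominate the coefficients of `Q`,
which are at most `β ^ m` and start at `m = r`. Hence each edge `y a` is prolonged by the paths
along `C`, up to a large length `N` since the entries have to remain polynomials. At a new vertex
there are then loops of the coprime lengths `r` and `r + 1` with strictly positive weights, which
yields primitivity. If `Q` has augmentation zero, `y` and `z` have the same augmentation, and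
prolonging the edges by one length at a time is a chain of strong shift equivalences.
-/

noncomputable section

namespace GExt

section Entries

variable {R S T U : Type*} {k l m n : Type*}

/-- All entries of the matrix `M` lie in `P`. -/
def EntriesIn [SetLike S R] (P : S) (M : Matrix l m R) : Prop := ∀ i j, M i j ∈ P

theorem EntriesIn.zero [AddMonoid R] [SetLike S R] [AddSubmonoidClass S R] (P : S) :
    EntriesIn P (0 : Matrix l m R) := fun _ _ => zero_mem P

theorem EntriesIn.one [Semiring R] [SetLike S R] [SubsemiringClass S R] [DecidableEq m] (P : S) :
    EntriesIn P (1 : Matrix m m R) := fun i j => by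
  rw [Matrix.one_apply]
  split_ifs
  exacts [one_mem P, zero_mem P]

theorem EntriesIn.add [AddMonoid R] [SetLike S R] [AddSubmonoidClass S R] {P : S}
    {M N : Matrix l m R} (hM : EntriesIn P M) (hN : EntriesIn P N) : EntriesIn P (M + N) :=
  fun i j => add_mem (hM i j) (hN i j)

theorem EntriesIn.mul_of_forall [NonUnitalNonAssocSemiring R] [SetLike S R] [SetLike T R]
    [SetLike U R] [AddSubmonoidClass U R] [Fintype m] {P : S} {Q : T} {O : U}
    (h : ∀ x ∈ P, ∀ y ∈ Q, x * y ∈ O) {M : Matrix l m R} {N : Matrix m n R} (hM : EntriesIn P M)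
    (hN : EntriesIn Q N) : EntriesIn O (M * N) :=
  fun i j => sum_mem fun x _ => h _ (hM i x) _ (hN x j)

theorem EntriesIn.mul [NonUnitalNonAssocSemiring R] [SetLike S R] [NonUnitalSubsemiringClass S R]
    [Fintype m] {P : S} {M : Matrix l m R} {N : Matrix m n R} (hM : EntriesIn P M)
    (hN : EntriesIn P N) : EntriesIn P (M * N) :=
  .mul_of_forall (fun _ hx _ hy => mul_mem hx hy) hM hN

theorem EntriesIn.pow [Semiring R] [SetLike S R] [SubsemiringClass S R] [Fintype m]
    [DecidableEq m] {P : S} {M : Matrix m m R} (hM : EntriesIn P M) (p : ℕ) :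
    EntriesIn P (M ^ p) := by
  induction p with
  | zero => exact pow_zero M ▸ .one P
  | succ p ih => exact pow_succ M p ▸ ih.mul hM

theorem EntriesIn.fromBlocks [SetLike S R] {P : S} {A : Matrix k m R} {B : Matrix k n R}
    {C : Matrix l m R} {D : Matrix l n R} (hA : EntriesIn P A) (hB : EntriesIn P B)
    (hC : EntriesIn P C) (hD : EntriesIn P D) : EntriesIn P (Matrix.fromBlocks A B C D) := by
  rintro (i | i) (j | j)
  exacts [hA i j, hB i j, hC i j, hD i j]

theorem EntriesIn.fromCols [SetLike S R] {P : S} {A : Matrix l m R} {B : Matrix l n R}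
    (hA : EntriesIn P A) (hB : EntriesIn P B) : EntriesIn P (Matrix.fromCols A B) := by
  rintro i (j | j)
  exacts [hA i j, hB i j]

theorem EntriesIn.fromRows [SetLike S R] {P : S} {A : Matrix k m R} {B : Matrix l m R}
    (hA : EntriesIn P A) (hB : EntriesIn P B) : EntriesIn P (Matrix.fromRows A B) := by
  rintro (i | i) j
  exacts [hA i j, hB i j]

end Entries

section PolynomialCones

variable {R : Type*} [Ring R] {l m n : Type*} {P : Subsemiring R}

/-- The polynomials `P[t]` with all coefficients in `P`. -/
def polyOver (P : Subsemiring R) : Subsemiring R[X] where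
  carrier := {p | ∀ e, p.coeff e ∈ P}
  zero_mem' _ := by simp
  one_mem' e := by
    rw [coeff_one]
    split_ifs
    exacts [one_mem P, zero_mem P]
  add_mem' hp hq e := by
    rw [coeff_add]
    exact add_mem (hp e) (hq e)
  mul_mem' hp hq e := by
    rw [coeff_mul]
    exact sum_mem fun x _ => mul_mem (hp _) (hq _)

/-- The polynomials `t P[t]` with all coefficients in `P` and without constant term. -/
def tPolyOver (P : Subsemiring R) : AddSubmonoid R[X] where
  carrier := {p | p.coeff 0 = 0 ∧ p ∈ polyOver P}
  zero_mem' := ⟨coeff_zero 0, zero_mem _⟩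
  add_mem' hp hq := ⟨by rw [coeff_add, hp.1, hq.1, add_zero], add_mem hp.2 hq.2⟩

theorem mul_mem_tPolyOver_left {p q : R[X]} (hp : p ∈ tPolyOver P) (hq : q ∈ polyOver P) :
    p * q ∈ tPolyOver P :=
  ⟨by rw [mul_coeff_zero, hp.1, zero_mul], mul_mem hp.2 hq⟩

theorem mul_mem_tPolyOver_right {p q : R[X]} (hp : p ∈ polyOver P) (hq : q ∈ tPolyOver P) :
    p * q ∈ tPolyOver P :=
  ⟨by rw [mul_coeff_zero, hq.1, mul_zero], mul_mem hp hq.2⟩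

theorem monomial_mem_polyOver {x : R} (e : ℕ) (hx : x ∈ P) :
    monomial e x ∈ polyOver P := fun d => by
  rw [coeff_monomial]
  split_ifs
  exacts [hx, zero_mem P]

theorem monomial_mem_tPolyOver {e : ℕ} (he : e ≠ 0) {x : R} (hx : x ∈ P) :
    monomial e x ∈ tPolyOver P :=
  ⟨coeff_monomial_of_ne _ he.symm, monomial_mem_polyOver e hx⟩

theorem EntriesIn.mul_tPolyOver_left [Fintype m] {M : Matrix l m R[X]} {N : Matrix m n R[X]}
    (hM : EntriesIn (tPolyOver P) M) (hN : EntriesIn (polyOver P) N) :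
    EntriesIn (tPolyOver P) (M * N) :=
  .mul_of_forall (fun _ hx _ hy => mul_mem_tPolyOver_left hx hy) hM hN

theorem EntriesIn.mul_tPolyOver_right [Fintype m] {M : Matrix l m R[X]} {N : Matrix m n R[X]}
    (hM : EntriesIn (polyOver P) M) (hN : EntriesIn (tPolyOver P) N) :
    EntriesIn (tPolyOver P) (M * N) :=
  .mul_of_forall (fun _ hx _ hy => mul_mem_tPolyOver_right hx hy) hM hN

theorem EntriesIn.of_tPolyOver {M : Matrix l m R[X]} (hM : EntriesIn (tPolyOver P) M) :
    EntriesIn (polyOver P) M := fun i j => (hM i j).2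

theorem EntriesIn.map_C {M : Matrix l m R} (hM : EntriesIn P M) :
    EntriesIn (polyOver P) (M.map Polynomial.C) := fun i j => monomial_mem_polyOver 0 (hM i j)

end PolynomialCones

section Degree

variable {R : Type*} [Ring R] {m : Type*} [Fintype m]

theorem polyDegree_le_iff {B : Matrix m m R[X]} {d : ℕ} :
    polyDegree B ≤ d ↔ 1 ≤ d ∧ ∀ i j e, d < e → (B i j).coeff e = 0 := by
  simp only [polyDegree, max_le_iff, Finset.sup_le_iff, Finset.mem_univ, true_implies,
    natDegree_le_iff_coeff_eq_zero]

theorem coeff_eq_zero_of_polyDegree_lt {B : Matrix m m R[X]} {e : ℕ} (he : polyDegree B < e)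
    (i j : m) : (B i j).coeff e = 0 :=
  (polyDegree_le_iff.1 le_rfl).2 i j e he

end Degree

section Elementary

variable {m n : Type*} [Fintype m] [DecidableEq m] [Fintype n] [DecidableEq n]
  {R : Type*} [Ring R]

theorem one_add_mem_El (p : m → Prop) (D : Matrix m m R)
    (hD : ∀ i j, D i j ≠ 0 → p i ∧ ¬ p j) : 1 + D ∈ El m R := by
  suffices key : ∀ s : Finset (m × m),
      1 + ∑ x ∈ s, Matrix.single x.1 x.2 (D x.1 x.2) ∈ El m R by
    rw [Matrix.matrix_eq_sum_single D, ← Finset.sum_product']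
    exact key _
  intro s
  induction s using Finset.induction_on with
  | empty => simp
  | insert x s hx ih =>
    rw [Finset.sum_insert hx]
    by_cases h0 : D x.1 x.2 = 0
    · simpa [h0] using ih
    have hmul : Matrix.single x.1 x.2 (D x.1 x.2) *
        ∑ y ∈ s, Matrix.single y.1 y.2 (D y.1 y.2) = 0 := by
      rw [Finset.mul_sum]
      refine Finset.sum_eq_zero fun y _ => ?_
      by_cases h1 : D y.1 y.2 = 0
      · simp [h1]
      · exact Matrix.single_mul_single_of_ne _ _ _ _
          (fun h => (hD _ _ h0).2 (by rw [h]; exact (hD _ _ h1).1)) _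
    have hfactor : 1 + (Matrix.single x.1 x.2 (D x.1 x.2) +
        ∑ y ∈ s, Matrix.single y.1 y.2 (D y.1 y.2)) =
        (1 + Matrix.single x.1 x.2 (D x.1 x.2)) *
          (1 + ∑ y ∈ s, Matrix.single y.1 y.2 (D y.1 y.2)) := by
      rw [add_mul, mul_add, mul_add, hmul]
      noncomm_ring
    rw [hfactor]
    exact mul_mem (Submonoid.subset_closure
      ⟨x.1, x.2, fun h => (hD _ _ h0).2 (by rw [← h]; exact (hD _ _ h0).1), _, rfl⟩) ih

theorem fromBlocks_one_zero_zero_mem_El {U : Matrix n n R} (hU : U ∈ El n R) :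
    Matrix.fromBlocks (1 : Matrix m m R) 0 0 U ∈ El (m ⊕ n) R := by
  induction hU using Submonoid.closure_induction with
  | mem U h =>
    obtain ⟨i, j, hij, r, rfl⟩ := h
    refine Submonoid.subset_closure ⟨.inr i, .inr j, by simpa using hij, r, ?_⟩
    rw [← Matrix.fromBlocks_one]
    ext (a | a) (b | b) <;> simp [Matrix.single_apply, Matrix.one_apply]
  | one => simp
  | mul U V _ _ hU hV => simpa [Matrix.fromBlocks_multiply] using mul_mem hU hV

theorem fromBlocks_zero_zero_one_mem_El {U : Matrix m m R} (hU : U ∈ El m R) :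
    Matrix.fromBlocks U 0 0 (1 : Matrix n n R) ∈ El (m ⊕ n) R := by
  induction hU using Submonoid.closure_induction with
  | mem U h =>
    obtain ⟨i, j, hij, r, rfl⟩ := h
    refine Submonoid.subset_closure ⟨.inl i, .inl j, by simpa using hij, r, ?_⟩
    rw [← Matrix.fromBlocks_one]
    ext (a | a) (b | b) <;> simp [Matrix.single_apply, Matrix.one_apply]
  | one => simp
  | mul U V _ _ hU hV => simpa [Matrix.fromBlocks_multiply] using mul_mem hU hV

theorem fromBlocks_one_upper_mem_El (X : Matrix m n R) :
    Matrix.fromBlocks (1 : Matrix m m R) X 0 (1 : Matrix n n R) ∈ El (m ⊕ n) R := by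
  have hsum : Matrix.fromBlocks (1 : Matrix m m R) X 0 (1 : Matrix n n R) =
      1 + Matrix.fromBlocks 0 X 0 0 := by
    simp [← Matrix.fromBlocks_one, Matrix.fromBlocks_add]
  rw [hsum]
  refine one_add_mem_El (fun x => x.isLeft = true) _ ?_
  rintro (i | i) (j | j) h <;> simp at h ⊢

theorem fromBlocks_one_lower_mem_El (X : Matrix n m R) :
    Matrix.fromBlocks (1 : Matrix m m R) 0 X (1 : Matrix n n R) ∈ El (m ⊕ n) R := by
  have hsum : Matrix.fromBlocks (1 : Matrix m m R) 0 X (1 : Matrix n n R) =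
      1 + Matrix.fromBlocks 0 0 X 0 := by
    simp [← Matrix.fromBlocks_one, Matrix.fromBlocks_add]
  rw [hsum]
  refine one_add_mem_El (fun x => x.isRight = true) _ ?_
  rintro (i | i) (j | j) h <;> simp at h ⊢

theorem ElEquiv.of_mul_mul {M N U V : Matrix m m R} (hU : U ∈ El m R) (hV : V ∈ El m R)
    (h : U * M * V = N) : ElEquiv M N :=
  ⟨0, _, fromBlocks_zero_zero_one_mem_El hU, _, fromBlocks_zero_zero_one_mem_El hV, by
    simp [Matrix.fromBlocks_multiply, h]⟩

theorem ElEquiv.fromBlocks_of_mul_left {Q P : Matrix m m R} {A C E : Matrix n n R}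
    {Y ρ : Matrix m n R} {S : Matrix n m R} (hE : E ∈ El n R)
    (hEA : E * (1 - A) = 1 - (S * Y + C)) (hP : P * (1 - Q) = 1) :
    ElEquiv (Matrix.fromBlocks (1 - Q) 0 0 (1 - A))
      (1 - Matrix.fromBlocks (Q + ((1 - Q) * Y + ρ * C) * S) ((1 - Q) * Y - ρ * (1 - C))
        (C * S) C) := by
  refine .of_mul_mul
    (U := Matrix.fromBlocks 1 ρ 0 1 * (Matrix.fromBlocks 1 0 (-(S * P)) 1 *
      Matrix.fromBlocks 1 0 0 E))
    (V := Matrix.fromBlocks 1 (-Y) 0 1 * Matrix.fromBlocks 1 0 S 1)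
    (mul_mem (fromBlocks_one_upper_mem_El _)
      (mul_mem (fromBlocks_one_lower_mem_El _) (fromBlocks_one_zero_zero_mem_El hE)))
    (mul_mem (fromBlocks_one_upper_mem_El _) (fromBlocks_one_lower_mem_El _)) ?_
  have hSP : -(S * P) * (1 - Q) = -S := by
    rw [Matrix.neg_mul, Matrix.mul_assoc, hP, Matrix.mul_one]
  have hrows : Matrix.fromBlocks 1 0 (-(S * P)) 1 * Matrix.fromBlocks 1 0 0 E *
      Matrix.fromBlocks (1 - Q) 0 0 (1 - A) =
      Matrix.fromBlocks (1 - Q) 0 (-S) (1 - (S * Y + C)) := by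
    simp only [Matrix.fromBlocks_multiply, Matrix.one_mul, Matrix.mul_one, Matrix.zero_mul,
      Matrix.mul_zero, add_zero, zero_add, hSP, hEA]
  have hcols : Matrix.fromBlocks (1 - Q) 0 (-S) (1 - (S * Y + C)) *
      Matrix.fromBlocks 1 (-Y) 0 1 = Matrix.fromBlocks (1 - Q) (-((1 - Q) * Y)) (-S) (1 - C) := by
    simp only [Matrix.fromBlocks_multiply, Matrix.mul_one, Matrix.mul_zero, add_zero,
      Matrix.mul_neg, Matrix.neg_mul, neg_neg]
    congr 1
    abel
  rw [Matrix.mul_assoc (Matrix.fromBlocks 1 ρ 0 1), hrows, ← Matrix.mul_assoc (_ * _),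
    Matrix.mul_assoc (Matrix.fromBlocks 1 ρ 0 1), hcols, ← Matrix.fromBlocks_one,
    sub_eq_add_neg (Matrix.fromBlocks _ _ _ _), Matrix.fromBlocks_neg, Matrix.fromBlocks_add]
  simp only [Matrix.fromBlocks_multiply, Matrix.one_mul, Matrix.mul_one, Matrix.zero_mul,
    Matrix.mul_zero, zero_add, Matrix.add_mul, Matrix.sub_mul, Matrix.mul_sub, Matrix.mul_neg,
    Matrix.neg_mul, Matrix.mul_assoc]
  congr 1 <;> abel

end Elementary

section StrongShift

variable {R : Type*} [Ring R] {P : Subsemiring R} {m n p : Type} [Fintype m] [Fintype n] [Fintype p]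

theorem SSE.of_mul_eq {M : Matrix m m R} {N : Matrix n n R} {U : Matrix m n R} {V : Matrix n m R}
    (hU : EntriesIn P U) (hV : EntriesIn P V) (hM : U * V = M) (hN : V * U = N) :
    SSE (P : Set R) M N :=
  hM ▸ hN ▸ .elementary U V hU hV

theorem SSE.refl {M : Matrix m m R} (hM : EntriesIn P M) : SSE (P : Set R) M M := by
  classical
  exact .of_mul_eq hM (.one P) (mul_one M) (one_mul M)

theorem SSE.symm {S : Set R} {M : Matrix m m R} {N : Matrix n n R} (h : SSE S M N) :
    SSE S N M := by
  induction h with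
  | elementary U V hU hV => exact .elementary V U hV hU
  | trans _ _ ih₁ ih₂ => exact ih₂.trans ih₁

theorem SSE.submatrix {M : Matrix m m R} (hM : EntriesIn P M) {f : n → m}
    (hf : Function.Injective f) (h : ∀ i, ∀ j ∉ Set.range f, M i j = 0) :
    SSE (P : Set R) M (M.submatrix f f) := by
  classical
  refine .of_mul_eq (U := M.submatrix id f) (V := (1 : Matrix m m R).submatrix f id)
    (fun i j => hM _ _) (fun i j => EntriesIn.one P (f i) j) ?_ ?_
  · ext i j
    simp only [Matrix.mul_apply, Matrix.submatrix_apply, id, Matrix.one_apply, mul_ite, mul_one,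
      mul_zero]
    by_cases hj : j ∈ Set.range f
    · obtain ⟨l, rfl⟩ := hj
      simp [hf.eq_iff]
    · rw [h i j hj]
      exact Finset.sum_eq_zero fun l _ => if_neg fun hl => hj ⟨l, hl⟩
  · ext i j
    simp [Matrix.mul_apply, Matrix.one_apply]

theorem SSE.add_mul {K : Matrix m m R} {X : Matrix m p R} {V : Matrix p m R}
    (hK : EntriesIn P K) (hX : EntriesIn P X) (hV : EntriesIn P V) :
    SSE (P : Set R) (K + X * V) (Matrix.fromBlocks K X (V * K) (V * X)) := by
  classical
  exact .of_mul_eq (U := Matrix.fromCols K X) (V := Matrix.fromRows 1 V) (hK.fromCols hX)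
    (.fromRows (.one P) hV) (by rw [Matrix.fromCols_mul_fromRows, Matrix.mul_one])
    (by rw [Matrix.fromRows_mul_fromCols, Matrix.one_mul, Matrix.one_mul])

/- Pulling the factor `W s` back along `K` one step at a time turns it into `W 0 = W' 0`. -/
theorem SSE.add_mul_chain {m p : Type} [Fintype m] [Fintype p] {K : Matrix m m R}
    {X : Matrix m p R} {W W' : ℕ → Matrix p m R} {s : ℕ} (hK : EntriesIn P K) (hX : EntriesIn P X)
    (hW : ∀ e, EntriesIn P (W e)) (hW' : ∀ e, EntriesIn P (W' e)) (h0 : W 0 = W' 0)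
    (hWK : ∀ e < s, W (e + 1) * K = W e) (hWX : ∀ e < s, W (e + 1) * X = 0)
    (hWK' : ∀ e < s, W' (e + 1) * K = W' e) (hWX' : ∀ e < s, W' (e + 1) * X = 0) :
    SSE (P : Set R) (K + X * W s) (K + X * W' s) := by
  classical
  induction s generalizing m p with
  | zero => exact h0 ▸ .refl (hK.add (hX.mul (hW 0)))
  | succ s ih =>
    have key := ih (K := Matrix.fromBlocks K X 0 0) (X := Matrix.fromRows 0 1)
      (W := fun e => Matrix.fromCols (W e) 0) (W' := fun e => Matrix.fromCols (W' e) 0)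
      (hK.fromBlocks hX (.zero P) (.zero P)) (.fromRows (.zero P) (.one P))
      (fun e => (hW e).fromCols (.zero P)) (fun e => (hW' e).fromCols (.zero P)) (by rw [h0])
      (fun e he => by simp [Matrix.fromCols_mul_fromBlocks, hWK e (by omega), hWX e (by omega)])
      (fun e _ => by simp [Matrix.fromCols_mul_fromRows])
      (fun e he => by simp [Matrix.fromCols_mul_fromBlocks, hWK' e (by omega), hWX' e (by omega)])
      (fun e _ => by simp [Matrix.fromCols_mul_fromRows])
    have hblocks : ∀ V : Matrix p m R, Matrix.fromBlocks K X V 0 =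
        Matrix.fromBlocks K X 0 0 +
          (Matrix.fromRows 0 1 : Matrix (m ⊕ p) p R) * Matrix.fromCols V 0 := fun V => by
      simp only [Matrix.fromRows_mul_fromCols, Matrix.fromBlocks_add, Matrix.zero_mul,
        Matrix.one_mul, add_zero, zero_add]
    have hsplit := SSE.add_mul hK hX (hW (s + 1))
    have hsplit' := SSE.add_mul hK hX (hW' (s + 1))
    rw [hWK s s.lt_succ_self, hWX s s.lt_succ_self, hblocks] at hsplit
    rw [hWK' s s.lt_succ_self, hWX' s s.lt_succ_self, hblocks] at hsplit'
    exact hsplit.trans (key.trans hsplit'.symm)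

end StrongShift

section Companion

variable {R : Type*} [Ring R] {m n p : Type*}

/-- The coefficient matrix `B_e` of `t ^ e` in a polynomial matrix `B = ∑ B_e t ^ e`. -/
def coeffMatrix (B : Matrix m n R[X]) (e : ℕ) : Matrix m n R := B.map fun q => q.coeff e

/-- The `L × L` block matrix with top block row `F 0, …, F (L - 1)` and with the blocks
`G 0, …, G (L - 2)` just below the diagonal. -/
def blockCompanion (L : ℕ) (F G : ℕ → Matrix m m R) : Matrix (Fin L × m) (Fin L × m) R :=
  Matrix.of fun x y =>
    if (x.1 : ℕ) = 0 then F y.1 x.2 y.2 else if (x.1 : ℕ) = y.1 + 1 then G y.1 x.2 y.2 else 0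

/-- The `L × L` block diagonal matrix with blocks `H 0, …, H (L - 1)`. -/
def blockDiag (L : ℕ) (H : ℕ → Matrix m m R) : Matrix (Fin L × m) (Fin L × m) R :=
  Matrix.of fun x y => if x.1 = y.1 then H y.1 x.2 y.2 else 0

/-- The block column of height `L` with `X` on top and zero blocks below. -/
def topBlock (L : ℕ) (X : Matrix m p R) : Matrix (Fin L × m) p R :=
  Matrix.of fun x j => if (x.1 : ℕ) = 0 then X x.2 j else 0

/-- The block row `N 0, …, N (L - 1)`. -/
def rowBlocks (L : ℕ) (N : ℕ → Matrix p m R) : Matrix p (Fin L × m) R :=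
  Matrix.of fun i y => N y.1 i y.2

theorem coeffMatrix_apply (B : Matrix m n R[X]) (e : ℕ) (i j) :
    coeffMatrix B e i j = (B i j).coeff e := rfl

theorem coeffMatrix_add (B B' : Matrix m n R[X]) (e : ℕ) :
    coeffMatrix (B + B') e = coeffMatrix B e + coeffMatrix B' e := by
  ext i j
  simp [coeffMatrix_apply]

theorem coeffMatrix_map_monomial (M : Matrix m n R) (s e : ℕ) :
    coeffMatrix (M.map (monomial s)) e = if s = e then M else 0 := by
  ext i j
  rw [coeffMatrix_apply, Matrix.map_apply, coeff_monomial]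
  split_ifs <;> rfl

theorem coeffMatrix_map_C_mul [Fintype n] (M : Matrix m n R) (B : Matrix n p R[X]) (e : ℕ) :
    coeffMatrix (M.map C * B) e = M * coeffMatrix B e := by
  ext i j
  simp [coeffMatrix_apply, Matrix.mul_apply]

theorem coeffMatrix_mul_map_C [Fintype n] (B : Matrix m n R[X]) (M : Matrix n p R) (e : ℕ) :
    coeffMatrix (B * M.map C) e = coeffMatrix B e * M := by
  ext i j
  simp [coeffMatrix_apply, Matrix.mul_apply]

theorem coeffMatrix_map_monomial_mul [Fintype n] (M : Matrix m n R) (B : Matrix n p R[X])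
    (s e : ℕ) : coeffMatrix (M.map (monomial s) * B) e =
      if s ≤ e then M * coeffMatrix B (e - s) else 0 := by
  ext i j
  simp only [coeffMatrix_apply, Matrix.mul_apply, finsetSum_coeff, Matrix.map_apply,
    ← C_mul_X_pow_eq_monomial, mul_assoc, coeff_C_mul, coeff_X_pow_mul']
  split_ifs <;> simp [Matrix.mul_apply, coeffMatrix_apply]

theorem coeffMatrix_zero {P : Subsemiring R} {B : Matrix m n R[X]}
    (hB : EntriesIn (tPolyOver P) B) : coeffMatrix B 0 = 0 := by
  ext i j
  exact (hB i j).1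

theorem EntriesIn.coeffMatrix {P : Subsemiring R} {B : Matrix m n R[X]}
    (hB : EntriesIn (polyOver P) B) (e : ℕ) : EntriesIn P (coeffMatrix B e) :=
  fun i j => hB i j e

theorem EntriesIn.blockCompanion {P : Subsemiring R} {F G : ℕ → Matrix m m R}
    (hF : ∀ b, EntriesIn P (F b)) (hG : ∀ b, EntriesIn P (G b)) (L : ℕ) :
    EntriesIn P (blockCompanion L F G) := fun x y => by
  simp only [GExt.blockCompanion, Matrix.of_apply]
  split_ifs
  exacts [hF _ _ _, hG _ _ _, zero_mem P]

theorem EntriesIn.blockDiag {P : Subsemiring R} {H : ℕ → Matrix m m R}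
    (hH : ∀ b, EntriesIn P (H b)) (L : ℕ) : EntriesIn P (blockDiag L H) := fun x y => by
  simp only [GExt.blockDiag, Matrix.of_apply]
  split_ifs
  exacts [hH _ _ _, zero_mem P]

theorem EntriesIn.topBlock {P : Subsemiring R} {X : Matrix m p R} (hX : EntriesIn P X) (L : ℕ) :
    EntriesIn P (topBlock L X) := fun x j => by
  simp only [GExt.topBlock, Matrix.of_apply]
  split_ifs
  exacts [hX _ _, zero_mem P]

theorem EntriesIn.rowBlocks {P : Subsemiring R} {N : ℕ → Matrix p m R}
    (hN : ∀ b, EntriesIn P (N b)) (L : ℕ) : EntriesIn P (rowBlocks L N) :=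
  fun _ _ => hN _ _ _

theorem blockCompanion_add_topBlock_mul_rowBlocks [Fintype p] (L : ℕ) (F G : ℕ → Matrix m m R)
    (X : Matrix m p R) (N : ℕ → Matrix p m R) :
    blockCompanion L F G + topBlock L X * rowBlocks L N =
      blockCompanion L (fun b => F b + X * N b) G := by
  ext x y
  by_cases hx : (x.1 : ℕ) = 0 <;>
    simp [blockCompanion, topBlock, rowBlocks, Matrix.mul_apply, hx]

theorem blockCompanion_congr {L : ℕ} {F F' : ℕ → Matrix m m R} (h : ∀ b < L, F b = F' b)
    (G : ℕ → Matrix m m R) : blockCompanion L F G = blockCompanion L F' G := by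
  ext x y
  simp only [blockCompanion, Matrix.of_apply, h _ y.1.2]

theorem blockDiag_eq_one [DecidableEq m] {L : ℕ} {H : ℕ → Matrix m m R} (h : ∀ b < L, H b = 1) :
    blockDiag L H = 1 := by
  ext x y
  simp only [blockDiag, Matrix.of_apply, h _ y.1.2, Matrix.one_apply, Prod.ext_iff, ite_and]

variable [Fintype m]

theorem rowBlocks_mul_topBlock {L : ℕ} (hL : 0 < L) (N : ℕ → Matrix n m R) (X : Matrix m p R) :
    rowBlocks L N * topBlock L X = N 0 * X := by
  ext i j
  simp only [Matrix.mul_apply, Fintype.sum_prod_type, rowBlocks, topBlock, Matrix.of_apply]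
  rw [Finset.sum_eq_single ⟨0, hL⟩ (fun b _ hb => by simp [Fin.ext_iff.not.1 hb]) (by simp)]
  simp

variable [DecidableEq m]

theorem blockCompanion_one_mul_blockDiag (L : ℕ) (F H : ℕ → Matrix m m R) :
    blockCompanion L F 1 * blockDiag L H = blockCompanion L (fun b => F b * H b) H := by
  ext x y
  simp only [Matrix.mul_apply, Fintype.sum_prod_type, blockCompanion, blockDiag, Matrix.of_apply]
  rw [Finset.sum_eq_single y.1 (fun b _ hb => by simp [hb]) (by simp)]
  by_cases hx : (x.1 : ℕ) = 0
  · simp [hx]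
  · by_cases hxy : (x.1 : ℕ) = y.1 + 1 <;> simp [hx, hxy, Matrix.one_apply]

theorem blockDiag_mul_blockCompanion_one (L : ℕ) (F H : ℕ → Matrix m m R) :
    blockDiag L H * blockCompanion L F 1 =
      blockCompanion L (fun b => H 0 * F b) fun b => H (b + 1) := by
  ext x y
  simp only [Matrix.mul_apply, Fintype.sum_prod_type, blockCompanion, blockDiag, Matrix.of_apply]
  rw [Finset.sum_eq_single x.1 (fun b _ hb => by simp [hb.symm]) (by simp)]
  by_cases hx : (x.1 : ℕ) = 0
  · simp [hx]
  · by_cases hxy : (x.1 : ℕ) = y.1 + 1 <;> simp [hx, hxy, Matrix.one_apply]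

theorem rowBlocks_mul_blockCompanion_one {L : ℕ} (N : ℕ → Matrix n m R) (hN : N L = 0)
    (F : ℕ → Matrix m m R) : rowBlocks L N * blockCompanion L F 1 =
      rowBlocks L fun b => N 0 * F b + N (b + 1) := by
  ext i ⟨⟨b, hb⟩, j⟩
  obtain ⟨L, rfl⟩ := Nat.exists_eq_succ_of_ne_zero hb.ne_bot
  simp only [Matrix.mul_apply, Fintype.sum_prod_type, rowBlocks, blockCompanion, Matrix.of_apply,
    Matrix.add_apply, Fin.sum_univ_succ, Fin.val_zero, if_true, Fin.val_succ, Nat.succ_ne_zero,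
    if_false, add_left_inj]
  congr 1
  rcases (Nat.le_of_lt_succ hb).lt_or_eq with hbL | rfl
  · rw [Finset.sum_eq_single ⟨b, hbL⟩
      (fun c _ hc => by simp [Fin.ext_iff.not.1 hc]) (by simp)]
    simp [Matrix.one_apply]
  · rw [hN]
    exact Finset.sum_eq_zero fun c _ => by simp [c.2.ne]

end Companion

section StrongShiftBox

variable {R : Type*} [Ring R] {P : Subsemiring R} {m n : Type} [Fintype m] [DecidableEq m]
  [Fintype n] [DecidableEq n]

/-- The block matrix `B^□` of `B` formed with `L × L` blocks, `L` possibly larger than the degree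
of `B`. -/
def polyCompanion {m : Type*} [DecidableEq m] (L : ℕ) (B : Matrix m m R[X]) :
    Matrix (Fin L × m) (Fin L × m) R :=
  blockCompanion L (fun b => coeffMatrix B (b + 1)) 1

theorem box_eq_polyCompanion {m : Type*} [Fintype m] [DecidableEq m] (B : Matrix m m R[X]) :
    box B = polyCompanion (polyDegree B) B := by
  ext x y
  simp only [box, polyCompanion, blockCompanion, Matrix.of_apply, coeffMatrix_apply, Pi.one_apply,
    Matrix.one_apply, ite_and]

theorem EntriesIn.polyCompanion {m : Type*} [DecidableEq m] {B : Matrix m m R[X]}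
    (hB : EntriesIn (polyOver P) B) (L : ℕ) : EntriesIn P (polyCompanion L B) :=
  .blockCompanion (fun b => hB.coeffMatrix (b + 1)) (fun _ => .one P) L

theorem EntriesIn.box {m : Type*} [Fintype m] [DecidableEq m] {B : Matrix m m R[X]}
    (hB : EntriesIn (polyOver P) B) : EntriesIn P (box B) :=
  box_eq_polyCompanion B ▸ hB.polyCompanion _

theorem sse_polyCompanion_succ {L : ℕ} {B : Matrix m m R[X]} (hB : EntriesIn (polyOver P) B)
    (h : coeffMatrix B (L + 1) = 0) :
    SSE (P : Set R) (polyCompanion (L + 1) B) (polyCompanion L B) := by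
  refine .submatrix (f := Prod.map Fin.castSucc id) (hB.polyCompanion _)
    (Fin.castSucc_injective L |>.prodMap Function.injective_id) fun x y hy => ?_
  have hy : y.1 = Fin.last L := by
    by_contra hne
    exact hy ⟨(y.1.castPred hne, y.2), by simp⟩
  simp only [polyCompanion, blockCompanion, Matrix.of_apply, hy, Fin.val_last, h,
    Matrix.zero_apply, x.1.2.ne, if_false, ite_self]

theorem sse_polyCompanion_box {L : ℕ} {B : Matrix m m R[X]} (hB : EntriesIn (polyOver P) B)
    (hL : polyDegree B ≤ L) : SSE (P : Set R) (polyCompanion L B) (box B) := by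
  induction L, hL using Nat.le_induction with
  | base => exact box_eq_polyCompanion B ▸ .refl hB.box
  | succ L hL ih =>
    refine (sse_polyCompanion_succ hB ?_).trans ih
    ext i j
    exact coeff_eq_zero_of_polyDegree_lt (by omega) i j

theorem sse_box_of_polyCompanion {B : Matrix m m R[X]} {B' : Matrix n n R[X]}
    (hB : EntriesIn (polyOver P) B) (hB' : EntriesIn (polyOver P) B') (L : ℕ)
    (h : ∀ L' ≥ L, SSE (P : Set R) (polyCompanion L' B) (polyCompanion L' B')) :
    SSE (P : Set R) (box B) (box B') := by
  let L' := L + polyDegree B + polyDegree B'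
  exact (sse_polyCompanion_box (L := L') hB (by omega)).symm.trans
    ((h L' (by omega)).trans (sse_polyCompanion_box hB' (by omega)))

/- Moving the constant factor `S` through the block companion matrix one block column at a time. -/
theorem sse_box_mul_comm {T : Matrix m m R[X]} {S : Matrix m m R}
    (hT : EntriesIn (polyOver P) T) (hS : EntriesIn P S) :
    SSE (P : Set R) (box (S.map C * T)) (box (T * S.map C)) := by
  refine sse_box_of_polyCompanion (hS.map_C.mul hT) (hT.mul hS.map_C) 0 fun L _ => ?_
  let V : ℕ → Matrix (Fin L × m) (Fin L × m) R := fun i => blockDiag L (Function.update 1 i S)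
  let U : ℕ → Matrix (Fin L × m) (Fin L × m) R := fun i => blockCompanion L
    (fun b => if b < i then coeffMatrix T (b + 1) * S else coeffMatrix T (b + 1)) 1
  have hV : ∀ i, EntriesIn P (V i) := fun i => .blockDiag (fun b => by
    rw [Function.update_apply]
    split_ifs
    exacts [hS, .one P]) L
  have hU : ∀ i, EntriesIn P (U i) := fun i => .blockCompanion (fun b => by
    split_ifs
    exacts [(hT.coeffMatrix _).mul hS, hT.coeffMatrix _]) (fun _ => .one P) L
  have hstep : ∀ i, U i * V i = V (i + 1) * U (i + 1) := fun i => by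
    simp only [U, V, blockCompanion_one_mul_blockDiag, blockDiag_mul_blockCompanion_one]
    congr 1 <;> ext1 b
    · rcases lt_trichotomy b i with h | rfl | h
      · simp [h, h.ne, h.trans i.lt_succ_self]
      · simp
      · simp [h.not_gt, h.ne', show ¬ b < i + 1 by omega]
    · simp [Function.update_apply]
  have hall : ∀ i, SSE (P : Set R) (V 0 * U 0) (V i * U i) := fun i => by
    induction i with
    | zero => exact .refl ((hV 0).mul (hU 0))
    | succ i ih => exact ih.trans (.of_mul_eq (hV i) (hU i) rfl (hstep i))
  have hsource : V 0 * U 0 = polyCompanion L (S.map C * T) := by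
    simp only [polyCompanion, U, V, blockDiag_mul_blockCompanion_one, coeffMatrix_map_C_mul]
    congr 1
  have htarget : V L * U L = polyCompanion L (T * S.map C) := by
    have hVL : V L = 1 := blockDiag_eq_one fun b hb => by
      rw [Function.update_of_ne hb.ne, Pi.one_apply]
    rw [hVL, one_mul, polyCompanion]
    exact blockCompanion_congr (fun b hb => by rw [if_pos hb, coeffMatrix_mul_map_C]) 1
  exact hsource ▸ htarget ▸ hall L

theorem polyCompanion_add {m n : Type*} [DecidableEq m] [Fintype n] {B B' : Matrix m m R[X]}
    {X : Matrix m n R} {N : ℕ → Matrix n m R} (h : ∀ b, coeffMatrix B' (b + 1) = X * N b) (L : ℕ) :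
    polyCompanion L (B + B') = polyCompanion L B + topBlock L X * rowBlocks L N := by
  simp only [polyCompanion, blockCompanion_add_topBlock_mul_rowBlocks, coeffMatrix_add, h]

/- An edge of the part `D t ^ s` ends in the set of vertices cut out by the projection `J`, where
no such edge starts; so it may be lengthened by the edge of `C` that follows it. -/
theorem sse_box_add_monomial {C : Matrix m m R[X]} {D J : Matrix m m R} {s : ℕ} (hs : s ≠ 0)
    (hC : EntriesIn (tPolyOver P) C) (hD : EntriesIn P D) (hJ : EntriesIn P J)
    (hDJ : D * J = D) (hJD : J * D = 0) :
    SSE (P : Set R) (box (C + D.map (monomial s))) (box (C + D.map (monomial s) * C)) := by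
  have hDs : EntriesIn (polyOver P) (D.map (monomial s)) := fun i j =>
    monomial_mem_polyOver s (hD i j)
  have hC' := hC.of_tPolyOver
  refine sse_box_of_polyCompanion (hC'.add hDs) (hC'.add (hDs.mul hC')) (s + polyDegree C)
    fun L hL => ?_
  let W : ℕ → ℕ → Matrix m m R := fun e b =>
    if e = 0 then J * coeffMatrix C (b + 1) else if b + 1 = e then J else 0
  let W' : ℕ → ℕ → Matrix m m R := fun e b => J * coeffMatrix C (b + 1 - e)
  have hsource (b : ℕ) : coeffMatrix (D.map (monomial s)) (b + 1) = D * W s b := by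
    simp only [W, if_neg hs, coeffMatrix_map_monomial, mul_ite, hDJ, mul_zero, eq_comm]
  have htarget (b : ℕ) : coeffMatrix (D.map (monomial s) * C) (b + 1) = D * W' s b := by
    rw [coeffMatrix_map_monomial_mul, ← mul_assoc, hDJ]
    split_ifs with h
    · rfl
    · rw [Nat.sub_eq_zero_of_le (by omega), coeffMatrix_zero hC, mul_zero]
  have hL0 : 0 < L := by omega
  rw [polyCompanion_add hsource, polyCompanion_add htarget]
  refine .add_mul_chain (W := fun e => rowBlocks L (W e)) (W' := fun e => rowBlocks L (W' e))
    (hC'.polyCompanion L) (hD.topBlock L) (fun e => .rowBlocks (fun b => ?_) L)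
    (fun e => .rowBlocks (fun b => hJ.mul (hC'.coeffMatrix _)) L) rfl (fun e he => ?_)
    (fun e _ => ?_) (fun e he => ?_) (fun e _ => ?_)
  · dsimp only [W]
    split_ifs
    exacts [hJ.mul (hC'.coeffMatrix _), hJ, .zero P]
  · rw [polyCompanion, rowBlocks_mul_blockCompanion_one _ (by simp [W]; omega)]
    congr 1
    ext1 b
    rcases eq_or_ne e 0 with rfl | he0
    · simp [W]
    · simp [W, he0]
  · rw [rowBlocks_mul_topBlock hL0]
    simp [W, hJD]
  · have hdeg : coeffMatrix C (L + 1 - (e + 1)) = 0 := by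
      ext i j
      exact coeff_eq_zero_of_polyDegree_lt (by omega) i j
    have hCL : W' (e + 1) L = 0 := by simp only [W', hdeg, mul_zero]
    rw [polyCompanion, rowBlocks_mul_blockCompanion_one _ hCL]
    congr 1
    ext1 b
    simp [W', coeffMatrix_zero hC, Nat.add_sub_add_right]
  · rw [rowBlocks_mul_topBlock hL0]
    simp [W', coeffMatrix_zero hC]

theorem sse_box_tMul {A : Matrix m m R} (hA : EntriesIn P A) :
    SSE (P : Set R) A (box (tMul A)) := by
  have htA : EntriesIn (polyOver P) (tMul A) := fun i j => monomial_mem_polyOver 1 (hA i j)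
  have hdeg : polyDegree (tMul A) ≤ 1 := polyDegree_le_iff.2 ⟨le_rfl, fun i j e he => by
    rw [tMul, Matrix.map_apply, coeff_monomial_of_ne _ he.ne']⟩
  have hsubmatrix :
      (polyCompanion 1 (tMul A)).submatrix (fun i => (0, i)) (fun i => (0, i)) = A := by
    ext i j
    simp [polyCompanion, blockCompanion, coeffMatrix_apply, tMul]
  have h := SSE.submatrix (htA.polyCompanion 1) (Prod.mk_right_injective (0 : Fin 1))
    fun x y hy => absurd ⟨y.2, Prod.ext (Subsingleton.elim _ _) rfl⟩ hy
  exact (hsubmatrix ▸ h).symm.trans (sse_polyCompanion_box htA hdeg)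

end StrongShiftBox

section FirstPassage

variable {R : Type*} [Ring R] {n : Type*} [Fintype n] [DecidableEq n]

/-- `firstPass A i₀ e j` counts, with the weights of `A`, the paths of length `e + 1` from `i₀` to
`j` that do not return to `i₀` before their end. -/
def firstPass (A : Matrix n n R) (i₀ : n) : ℕ → n → R
  | 0 => A i₀
  | e + 1 => fun j => ∑ l, if l = i₀ then 0 else firstPass A i₀ e l * A l j

/-- The first return loops of length at most `q + 1` at `i₀`, together with the edges of `tA` that
start at the other vertices. -/
def expandRowLoops (A : Matrix n n R) (i₀ : n) (q : ℕ) : Matrix n n R[X] :=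
  Matrix.of fun i j =>
    if i = i₀ then
      if j = i₀ then ∑ e ∈ Finset.range (q + 1), monomial (e + 1) (firstPass A i₀ e i₀) else 0
    else monomial 1 (A i j)

/-- The paths of length `q + 1` from `i₀` to other vertices that do not return to `i₀`. -/
def expandRowExit (A : Matrix n n R) (i₀ : n) (q : ℕ) : Matrix n n R :=
  Matrix.of fun i j => if i = i₀ ∧ j ≠ i₀ then firstPass A i₀ q j else 0

/-- The matrix obtained from `tA` by replacing the edges that leave `i₀` with the paths from `i₀`
that have length `q + 1`, or end with their first return to `i₀`. -/
def expandRow (A : Matrix n n R) (i₀ : n) (q : ℕ) : Matrix n n R[X] :=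
  expandRowLoops A i₀ q + (expandRowExit A i₀ q).map (monomial (q + 1))

theorem expandRow_zero (A : Matrix n n R) (i₀ : n) : expandRow A i₀ 0 = tMul A := by
  ext1 i j
  simp only [expandRow, expandRowLoops, expandRowExit, tMul, Matrix.add_apply, Matrix.of_apply,
    Matrix.map_apply]
  by_cases hi : i = i₀
  · by_cases hj : j = i₀ <;> simp [hi, hj, firstPass]
  · simp [hi]

theorem expandRowExit_mul_expandRowLoops (A : Matrix n n R) (i₀ : n) (q : ℕ) :
    (expandRowExit A i₀ q).map (monomial (q + 1)) * expandRowLoops A i₀ q =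
      Matrix.of fun i j => if i = i₀ then monomial (q + 2) (firstPass A i₀ (q + 1) j) else 0 := by
  ext1 i j
  simp only [Matrix.mul_apply, Matrix.of_apply, expandRowExit, Matrix.map_apply]
  by_cases hi : i = i₀
  · simp only [hi, true_and, if_true, firstPass, map_sum]
    refine Finset.sum_congr rfl fun l _ => ?_
    by_cases hl : l = i₀ <;> simp [expandRowLoops, hl, monomial_mul_monomial]
  · simp [hi]

theorem expandRow_succ (A : Matrix n n R) (i₀ : n) (q : ℕ) :
    expandRow A i₀ (q + 1) = expandRowLoops A i₀ q +
      (expandRowExit A i₀ q).map (monomial (q + 1)) * expandRowLoops A i₀ q := by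
  rw [expandRowExit_mul_expandRowLoops]
  ext1 i j
  simp only [expandRow, expandRowLoops, expandRowExit, Matrix.add_apply, Matrix.of_apply,
    Matrix.map_apply]
  by_cases hi : i = i₀
  · by_cases hj : j = i₀
    · simp [hi, hj, Finset.sum_range_succ _ (q + 1)]
    · simp [hi, hj]
  · simp [hi]

theorem exists_El_expandRow (A : Matrix n n R) (i₀ : n) (q : ℕ) :
    ∃ E ∈ El n R[X], E * (1 - tMul A) = 1 - expandRow A i₀ q := by
  induction q with
  | zero => exact ⟨1, one_mem _, by rw [expandRow_zero, one_mul]⟩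
  | succ q ih =>
    obtain ⟨E, hE, h⟩ := ih
    let D := (expandRowExit A i₀ q).map (monomial (q + 1))
    have hDD : D * D = 0 := by
      ext1 i j
      refine Finset.sum_eq_zero fun l _ => ?_
      by_cases hl : l = i₀ <;> simp [D, expandRowExit, hl]
    have hD : 1 + D ∈ El n R[X] := one_add_mem_El (· = i₀) D fun i j hij => by
      by_contra hne
      exact hij (by simp [D, expandRowExit, show ¬(i = i₀ ∧ j ≠ i₀) from hne])
    refine ⟨(1 + D) * E, mul_mem hD hE, ?_⟩
    calc (1 + D) * E * (1 - tMul A) = (1 + D) * (1 - (expandRowLoops A i₀ q + D)) := by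
          rw [mul_assoc, h, expandRow]
      _ = 1 - (expandRowLoops A i₀ q + D * expandRowLoops A i₀ q) - D * D := by noncomm_ring
      _ = 1 - expandRow A i₀ (q + 1) := by rw [hDD, sub_zero, expandRow_succ]

theorem map_firstPass {R' : Type*} [Ring R'] (f : R →+* R') (A : Matrix n n R) (i₀ : n) (e : ℕ)
    (j : n) : f (firstPass A i₀ e j) = firstPass (A.map f) i₀ e j := by
  induction e generalizing j with
  | zero => rfl
  | succ e ih =>
    simp only [firstPass, map_sum]
    refine Finset.sum_congr rfl fun l _ => ?_
    split_ifs
    · exact map_zero f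
    · rw [map_mul, ih, Matrix.map_apply]

theorem map_expandRow {R' : Type*} [Ring R'] (f : R →+* R') (A : Matrix n n R) (i₀ : n) (q : ℕ) :
    (expandRow A i₀ q).map (mapRingHom f) = expandRow (A.map f) i₀ q := by
  ext1 i j
  simp only [expandRow, expandRowLoops, expandRowExit, Matrix.add_apply, Matrix.of_apply,
    Matrix.map_apply, coe_mapRingHom, Polynomial.map_add, map_monomial, ← map_firstPass f]
  congr 1
  · by_cases hi : i = i₀
    · by_cases hj : j = i₀ <;> simp [hi, hj, Polynomial.map_sum]
    · simp [hi]
  · by_cases h : i = i₀ ∧ j ≠ i₀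
    · simp [h]
    · simp only [h, if_false, map_zero]

variable {P : Subsemiring R} {A : Matrix n n R}

theorem firstPass_mem (hA : EntriesIn P A) (i₀ : n) (e : ℕ) (j : n) : firstPass A i₀ e j ∈ P := by
  induction e generalizing j with
  | zero => exact hA i₀ j
  | succ e ih =>
    refine sum_mem fun l _ => ?_
    split_ifs
    exacts [zero_mem P, mul_mem (ih l) (hA l j)]

theorem EntriesIn.expandRowLoops (hA : EntriesIn P A) (i₀ : n) (q : ℕ) :
    EntriesIn (tPolyOver P) (expandRowLoops A i₀ q) := fun i j => by
  rw [GExt.expandRowLoops, Matrix.of_apply]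
  split_ifs
  · exact sum_mem fun e _ => monomial_mem_tPolyOver e.succ_ne_zero (firstPass_mem hA i₀ e i₀)
  · exact zero_mem _
  · exact monomial_mem_tPolyOver one_ne_zero (hA i j)

theorem EntriesIn.expandRowExit (hA : EntriesIn P A) (i₀ : n) (q : ℕ) :
    EntriesIn P (expandRowExit A i₀ q) := fun i j => by
  rw [GExt.expandRowExit, Matrix.of_apply]
  split_ifs
  exacts [firstPass_mem hA i₀ q j, zero_mem P]

theorem sse_expandRow {n : Type} [Fintype n] [DecidableEq n] {A : Matrix n n R}
    (hA : EntriesIn P A) (i₀ : n) (q : ℕ) : SSE (P : Set R) A (box (expandRow A i₀ q)) := by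
  induction q with
  | zero => exact expandRow_zero A i₀ ▸ sse_box_tMul hA
  | succ q ih =>
    let J : Matrix n n R := Matrix.diagonal fun i => if i = i₀ then 0 else 1
    have hJ : EntriesIn P J := fun i j => by
      simp only [J, Matrix.diagonal_apply]
      split_ifs
      exacts [zero_mem P, one_mem P, zero_mem P]
    rw [expandRow_succ]
    refine ih.trans (sse_box_add_monomial q.succ_ne_zero (hA.expandRowLoops i₀ q)
      (hA.expandRowExit i₀ q) hJ ?_ ?_)
    · ext i j
      by_cases hj : j = i₀ <;> simp [J, expandRowExit, hj]
    · ext i j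
      by_cases hi : i = i₀ <;> simp [J, expandRowExit, hi]

theorem firstPass_fromBlocks {k : Type*} [Fintype k] [DecidableEq k] (A : Matrix n n R) (i₀ : n)
    (e : ℕ) : firstPass (Matrix.fromBlocks (0 : Matrix k k R) 0 0 A) (.inr i₀) e =
      Sum.elim (0 : k → R) (firstPass A i₀ e) := by
  induction e with
  | zero => rfl
  | succ e ih =>
    ext (j | j) <;> simp [firstPass, ih, Fintype.sum_sum_type]

theorem expandRow_fromBlocks {k : Type*} [Fintype k] [DecidableEq k] (A : Matrix n n R) (i₀ : n)
    (q : ℕ) : expandRow (Matrix.fromBlocks (0 : Matrix k k R) 0 0 A) (.inr i₀) q =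
      Matrix.fromBlocks 0 0 0 (expandRow A i₀ q) := by
  ext1 (i | i) (j | j) <;>
    simp [expandRow, expandRowLoops, expandRowExit, firstPass_fromBlocks]

theorem sse_fromBlocks_expandRow {k n : Type} [Fintype k] [DecidableEq k] [Fintype n]
    [DecidableEq n] {A : Matrix n n R} (hA : EntriesIn P A) (i₀ : n) (q : ℕ) :
    SSE (P : Set R) A
      (box (Matrix.fromBlocks (0 : Matrix k k R[X]) 0 0 (expandRow A i₀ q))) := by
  have hA' : EntriesIn P (Matrix.fromBlocks (0 : Matrix k k R) 0 0 A) :=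
    .fromBlocks (.zero P) (.zero P) (.zero P) hA
  have hpad := SSE.submatrix hA' Sum.inr_injective fun i j hj => by
    rcases j with j | j
    · rcases i with i | i <;> rfl
    · exact absurd ⟨j, rfl⟩ hj
  exact expandRow_fromBlocks (k := k) A i₀ q ▸ hpad.symm.trans (sse_expandRow hA' _ q)

end FirstPassage

section PathBlocks

variable {R : Type*} [Ring R] {P : Subsemiring R} {k l m n : Type*}

/-- The part of degree less than `s` of a polynomial matrix. -/
def truncDeg (s : ℕ) (M : Matrix l m R[X]) : Matrix l m R[X] :=
  M.map fun p => PowerSeries.trunc s (p : PowerSeries R)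

theorem coeff_truncDeg (s : ℕ) (M : Matrix l m R[X]) (i : l) (j : m) (e : ℕ) :
    (truncDeg s M i j).coeff e = if e < s then (M i j).coeff e else 0 := by
  rw [truncDeg, Matrix.map_apply, PowerSeries.coeff_trunc, coeff_coe]

theorem truncDeg_succ (s : ℕ) (M : Matrix l m R[X]) :
    truncDeg (s + 1) M = truncDeg s M + (coeffMatrix M s).map (monomial s) := by
  ext1 i j
  simp [truncDeg, coeffMatrix, PowerSeries.trunc_succ]

theorem EntriesIn.truncDeg {M : Matrix l m R[X]} (hM : EntriesIn (polyOver P) M) (s : ℕ) :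
    EntriesIn (polyOver P) (truncDeg s M) := fun i j e => by
  rw [coeff_truncDeg]
  split_ifs
  exacts [hM i j e, zero_mem P]

theorem exists_truncDeg_eq_self [Finite l] [Finite m] (M : Matrix l m R[X]) :
    ∃ s, truncDeg (s + 1) M = M := by
  cases nonempty_fintype l
  cases nonempty_fintype m
  refine ⟨∑ i, ∑ j, (M i j).natDegree, ?_⟩
  ext i j e
  rw [coeff_truncDeg]
  split_ifs with h
  · rfl
  · refine (coeff_eq_zero_of_natDegree_lt (lt_of_le_of_lt ?_ (not_lt.1 h))).symm
    exact (Finset.single_le_sum_of_canonicallyOrdered (Finset.mem_univ j)).trans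
      (Finset.single_le_sum_of_canonicallyOrdered
        (f := fun i => ∑ j, (M i j).natDegree) (Finset.mem_univ i))

theorem coeff_truncDeg_mul [Fintype m] {M : Matrix l m R[X]} {N : Matrix m n R[X]}
    (hN : EntriesIn (tPolyOver P) N) {s e : ℕ} (he : e ≤ s) (i : l) (j : n) :
    ((truncDeg s M * N) i j).coeff e = ((M * N) i j).coeff e := by
  simp only [Matrix.mul_apply, finsetSum_coeff, coeff_mul]
  refine Finset.sum_congr rfl fun x _ => Finset.sum_congr rfl fun y hy => ?_
  rw [coeff_truncDeg]
  split_ifs with h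
  · rfl
  · have hy2 : y.2 = 0 := by
      have := Finset.HasAntidiagonal.mem_antidiagonal.1 hy
      omega
    rw [hy2, (hN x j).1, mul_zero, mul_zero]

variable [Fintype n] [DecidableEq n]

/-- The matrix of the paths through the vertices of `C` along `ρ`, starting from the edges `Y` and
ending with the edges `S`. -/
def pathBlocks (Y ρ : Matrix k n R[X]) (S : Matrix n k R[X]) (C : Matrix n n R[X]) :
    Matrix (k ⊕ n) (k ⊕ n) R[X] :=
  Matrix.fromBlocks ((Y + ρ * C) * S) (Y - ρ * (1 - C)) (C * S) C

variable {Y ρ : Matrix k n R[X]} {C : Matrix n n R[X]}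

/-- The part of `pathBlocks` along the paths of length less than `s` that is kept when the
paths of length `s` are added. -/
def pathBlocksCore (Y ρ : Matrix k n R[X]) (S : Matrix n k R[X]) (C : Matrix n n R[X]) (s : ℕ) :
    Matrix (k ⊕ n) (k ⊕ n) R[X] :=
  Matrix.fromBlocks ((Y + truncDeg s ρ * C) * S) (Y + truncDeg s ρ * C - truncDeg (s + 1) ρ)
    (C * S) C

theorem pathBlocks_truncDeg (Y ρ : Matrix k n R[X]) (S : Matrix n k R[X]) (C : Matrix n n R[X])
    (s : ℕ) : pathBlocks Y (truncDeg s ρ) S C = pathBlocksCore Y ρ S C s +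
      (Matrix.fromBlocks (0 : Matrix k k R) (coeffMatrix ρ s) 0 (0 : Matrix n n R)).map
        (monomial s) := by
  rw [Matrix.fromBlocks_map, pathBlocks, pathBlocksCore, Matrix.fromBlocks_add,
    Matrix.fromBlocks_inj, truncDeg_succ]
  refine ⟨?_, ?_, ?_, ?_⟩ <;> simp [Matrix.mul_sub, Matrix.map_zero]
  abel

theorem pathBlocks_truncDeg_succ [Fintype k] (Y ρ : Matrix k n R[X]) (S : Matrix n k R[X])
    (C : Matrix n n R[X]) (s : ℕ) :
    pathBlocks Y (truncDeg (s + 1) ρ) S C = pathBlocksCore Y ρ S C s +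
      (Matrix.fromBlocks (0 : Matrix k k R) (coeffMatrix ρ s) 0 (0 : Matrix n n R)).map
        (monomial s) * pathBlocksCore Y ρ S C s := by
  rw [Matrix.fromBlocks_map, pathBlocks, pathBlocksCore, Matrix.fromBlocks_multiply,
    Matrix.fromBlocks_add, Matrix.fromBlocks_inj, truncDeg_succ]
  refine ⟨?_, ?_, ?_, ?_⟩ <;>
    simp [Matrix.mul_sub, Matrix.add_mul, Matrix.mul_assoc, Matrix.map_zero, add_assoc]
  abel

theorem EntriesIn.pathBlocksCore (hY : EntriesIn (tPolyOver P) Y) (hρ : EntriesIn (tPolyOver P) ρ)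
    {S : Matrix n k R[X]} (hS : EntriesIn (polyOver P) S) (hC : EntriesIn (tPolyOver P) C)
    (hτ : EntriesIn (polyOver P) (Y - ρ * (1 - C))) (s : ℕ) :
    EntriesIn (tPolyOver P) (pathBlocksCore Y ρ S C s) := by
  have hYC : EntriesIn (tPolyOver P) (Y + GExt.truncDeg s ρ * C) :=
    hY.add ((hρ.of_tPolyOver.truncDeg s).mul_tPolyOver_right hC)
  refine .fromBlocks (hYC.mul_tPolyOver_left hS) (fun i j => ⟨?_, fun e => ?_⟩)
    (hC.mul_tPolyOver_left hS) hC
  · rw [Matrix.sub_apply, coeff_sub, (hYC i j).1, coeff_truncDeg, (hρ i j).1, ite_self, sub_zero]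
  · rw [Matrix.sub_apply, coeff_sub, coeff_truncDeg]
    split_ifs with he
    · convert hτ i j e using 1
      rw [Matrix.add_apply, coeff_add, coeff_truncDeg_mul hC (by omega)]
      simp [Matrix.mul_sub]
      abel
    · rw [sub_zero]
      exact (hYC i j).2 e

theorem sse_fromBlocks_pathBlocks_zero {k n : Type} [Fintype k] [DecidableEq k] [Fintype n]
    [DecidableEq n] {Y : Matrix k n R[X]} {S : Matrix n k R} {C : Matrix n n R[X]}
    (hY : EntriesIn (polyOver P) Y) (hS : EntriesIn P S) (hC : EntriesIn (polyOver P) C) :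
    SSE (P : Set R)
      (box (Matrix.fromBlocks (0 : Matrix k k R[X]) 0 0 (S.map Polynomial.C * Y + C)))
      (box (pathBlocks Y 0 (S.map Polynomial.C) C)) := by
  let T : Matrix (k ⊕ n) (k ⊕ n) R[X] := Matrix.fromBlocks 0 Y 0 C
  let U : Matrix (k ⊕ n) (k ⊕ n) R := Matrix.fromBlocks 0 0 S 1
  have hU : U.map Polynomial.C = Matrix.fromBlocks 0 0 (S.map Polynomial.C) 1 := by
    rw [Matrix.fromBlocks_map]
    simp [Matrix.map_zero, Matrix.map_one]
  have h := sse_box_mul_comm (T := T) (S := U)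
    (.fromBlocks (.zero _) hY (.zero _) hC) (.fromBlocks (.zero P) (.zero P) hS (.one P))
  rw [hU] at h
  have hUT : Matrix.fromBlocks 0 0 (S.map Polynomial.C) 1 * T =
      Matrix.fromBlocks (0 : Matrix k k R[X]) 0 0 (S.map Polynomial.C * Y + C) := by
    simp [T, Matrix.fromBlocks_multiply]
  have hTU : T * Matrix.fromBlocks 0 0 (S.map Polynomial.C) 1 =
      pathBlocks Y 0 (S.map Polynomial.C) C := by
    simp [T, Matrix.fromBlocks_multiply, pathBlocks]
  exact hUT ▸ hTU ▸ h

/- The paths along `ρ` are added in the order of their lengths. -/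
theorem sse_pathBlocks {k n : Type} [Fintype k] [DecidableEq k] [Fintype n] [DecidableEq n]
    {A : Matrix n n R} {i₀ : n} {q : ℕ} {Y ρ : Matrix k n R[X]} {S : Matrix n k R}
    {C : Matrix n n R[X]} (hA : EntriesIn P A) (hY : EntriesIn (tPolyOver P) Y)
    (hρ : EntriesIn (tPolyOver P) ρ) (hS : EntriesIn P S) (hC : EntriesIn (tPolyOver P) C)
    (hτ : EntriesIn (polyOver P) (Y - ρ * (1 - C)))
    (hAC : expandRow A i₀ q = S.map Polynomial.C * Y + C) :
    SSE (P : Set R) A (box (pathBlocks Y ρ (S.map Polynomial.C) C)) := by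
  suffices h : ∀ s, SSE (P : Set R) A
      (box (pathBlocks Y (truncDeg (s + 1) ρ) (S.map Polynomial.C) C)) by
    obtain ⟨s, hs⟩ := exists_truncDeg_eq_self ρ
    exact hs ▸ h s
  intro s
  induction s with
  | zero =>
    have hρ1 : truncDeg 1 ρ = 0 := by
      ext i j e
      rcases e with - | e <;> simp [coeff_truncDeg, (hρ i j).1]
    rw [zero_add, hρ1]
    exact (hAC ▸ sse_fromBlocks_expandRow hA i₀ q).trans
      (sse_fromBlocks_pathBlocks_zero hY.of_tPolyOver hS hC.of_tPolyOver)
  | succ s ih =>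
    refine ih.trans ?_
    rw [pathBlocks_truncDeg, pathBlocks_truncDeg_succ]
    exact sse_box_add_monomial (J := Matrix.fromBlocks 0 0 0 1) s.succ_ne_zero
      (hY.pathBlocksCore hρ hS.map_C hC hτ (s + 1))
      (.fromBlocks (.zero P) (hρ.of_tPolyOver.coeffMatrix _) (.zero P) (.zero P))
      (.fromBlocks (.zero P) (.zero P) (.zero P) (.one P))
      (by simp [Matrix.fromBlocks_multiply]) (by simp [Matrix.fromBlocks_multiply])

end PathBlocks

section Positivity

theorem coeff_sum_apply {G ι : Type*} (s : Finset ι) (f : ι → ZG G) (g : G) :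
    (∑ i ∈ s, f i).coeff g = ∑ i ∈ s, (f i).coeff g := by
  rw [MonoidAlgebra.coeff_sum, Finsupp.finsetSum_apply]

variable {G : Type*} [Group G] {x y : ZG G}

variable (G) in
/-- The cone `ℤ₊G` in `ℤG`. -/
def nonnegCone : Subsemiring (ZG G) where
  carrier := {x | Nonneg x}
  zero_mem' _ := by simp
  one_mem' g := by
    classical
    rw [MonoidAlgebra.one_def, MonoidAlgebra.coeff_single, Finsupp.single_apply]
    split_ifs <;> simp
  add_mem' hx hy g := by
    rw [MonoidAlgebra.coeff_add]
    exact add_nonneg (hx g) (hy g)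
  mul_mem' hx hy g := by
    rw [MonoidAlgebra.coeff_mul_apply_left]
    exact Finset.sum_nonneg fun h _ => mul_nonneg (hx h) (hy _)

theorem single_mem_nonnegCone (g : G) {c : ℤ} (hc : 0 ≤ c) :
    MonoidAlgebra.single g c ∈ nonnegCone G := fun h => by
  classical
  rw [MonoidAlgebra.coeff_single, Finsupp.single_apply]
  split_ifs
  exacts [hc, le_rfl]

theorem aug_nonneg (hx : x ∈ nonnegCone G) : 0 ≤ aug x := by
  rw [aug_apply]
  exact Finset.sum_nonneg fun g _ => hx g

theorem coeff_le_aug (hx : x ∈ nonnegCone G) (g : G) : x.coeff g ≤ aug x := by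
  by_cases hg : g ∈ x.coeff.support
  · rw [aug_apply]
    exact Finset.single_le_sum (f := x.coeff) (fun h _ => hx h) hg
  · rw [Finsupp.notMem_support_iff.1 hg]
    exact aug_nonneg hx

theorem exists_coeff_pos (hx : x ∈ nonnegCone G) (h : x ≠ 0) : ∃ g, 0 < x.coeff g := by
  by_contra! hle
  exact h (MonoidAlgebra.coeff_eq_zero.1 (Finsupp.ext fun g => (hle g).antisymm (hx g)))

theorem aug_pos (hx : x ∈ nonnegCone G) (h : x ≠ 0) : 0 < aug x :=
  let ⟨g, hg⟩ := exists_coeff_pos hx h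
  hg.trans_le (coeff_le_aug hx g)

theorem mul_ne_zero_of_mem (hx : x ∈ nonnegCone G) (hy : y ∈ nonnegCone G) (hx0 : x ≠ 0)
    (hy0 : y ≠ 0) : x * y ≠ 0 := fun h =>
  (mul_pos (aug_pos hx hx0) (aug_pos hy hy0)).ne' (by rw [← map_mul, h, map_zero])

theorem sum_ne_zero_of_mem {ι : Type*} {s : Finset ι} {f : ι → ZG G}
    (h : ∀ i ∈ s, f i ∈ nonnegCone G) {i : ι} (hi : i ∈ s) (hf : f i ≠ 0) : ∑ i ∈ s, f i ≠ 0 := by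
  intro h0
  have hsum : 0 < ∑ i ∈ s, aug (f i) :=
    Finset.sum_pos' (fun j hj => aug_nonneg (h j hj)) ⟨i, hi, aug_pos (h i hi) hf⟩
  rw [← map_sum, h0, map_zero] at hsum
  exact hsum.false

theorem mul_aug_le_coeff_mul {c : ℝ} (hx : ∀ g, c ≤ (x.coeff g : ℝ)) (hy : y ∈ nonnegCone G)
    (g : G) : c * aug y ≤ ((x * y).coeff g : ℝ) := by
  rw [MonoidAlgebra.coeff_mul_apply_right, aug_apply, Finsupp.sum, Finsupp.sum]
  push_cast
  rw [Finset.mul_sum]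
  exact Finset.sum_le_sum fun h _ =>
    mul_le_mul_of_nonneg_right (hx _) (Int.cast_nonneg (hy h))

theorem StrictlyPos.ne_zero (hx : StrictlyPos x) : x ≠ 0 := by
  rintro rfl
  exact (hx 1).ne rfl

theorem StrictlyPos.mul_right (hx : StrictlyPos x) (hy : y ∈ nonnegCone G) (hy0 : y ≠ 0) :
    StrictlyPos (x * y) := fun g => by
  obtain ⟨h, hh⟩ := exists_coeff_pos hy hy0
  rw [MonoidAlgebra.coeff_mul_apply_right]
  exact Finset.sum_pos' (fun l _ => mul_nonneg (hx _).le (hy l))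
    ⟨h, Finsupp.mem_support_iff.2 hh.ne', mul_pos (hx _) hh⟩

theorem StrictlyPos.mul_left (hy : StrictlyPos y) (hx : x ∈ nonnegCone G) (hx0 : x ≠ 0) :
    StrictlyPos (x * y) := fun g => by
  obtain ⟨h, hh⟩ := exists_coeff_pos hx hx0
  rw [MonoidAlgebra.coeff_mul_apply_left]
  exact Finset.sum_pos' (fun l _ => mul_nonneg (hx l) (hy _).le)
    ⟨h, Finsupp.mem_support_iff.2 hh.ne', mul_pos hh (hy _)⟩

theorem StrictlyPos.sum {ι : Type*} {s : Finset ι} {f : ι → ZG G}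
    (h : ∀ i ∈ s, f i ∈ nonnegCone G) {i : ι} (hi : i ∈ s) (hf : StrictlyPos (f i)) :
    StrictlyPos (∑ i ∈ s, f i) := fun g => by
  rw [coeff_sum_apply]
  exact Finset.sum_pos' (fun j hj => h j hj g) ⟨i, hi, hf g⟩

end Positivity

section Primitivity

variable {G : Type*} [Group G] {l m n : Type*} [Fintype m]

theorem mul_apply_ne_zero {M : Matrix l m (ZG G)} {N : Matrix m n (ZG G)}
    (hM : EntriesIn (nonnegCone G) M) (hN : EntriesIn (nonnegCone G) N) {i : l} {j : m} {k : n}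
    (hij : M i j ≠ 0) (hjk : N j k ≠ 0) : (M * N) i k ≠ 0 :=
  sum_ne_zero_of_mem (fun x _ => mul_mem (hM i x) (hN x k)) (Finset.mem_univ j)
    (mul_ne_zero_of_mem (hM i j) (hN j k) hij hjk)

theorem StrictlyPos.mul_apply_right {M : Matrix l m (ZG G)} {N : Matrix m n (ZG G)}
    (hM : EntriesIn (nonnegCone G) M) (hN : EntriesIn (nonnegCone G) N) {i : l} {j : m} {k : n}
    (hij : StrictlyPos (M i j)) (hjk : N j k ≠ 0) : StrictlyPos ((M * N) i k) :=
  .sum (fun x _ => mul_mem (hM i x) (hN x k)) (Finset.mem_univ j) (hij.mul_right (hN j k) hjk)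

theorem StrictlyPos.mul_apply_left {M : Matrix l m (ZG G)} {N : Matrix m n (ZG G)}
    (hM : EntriesIn (nonnegCone G) M) (hN : EntriesIn (nonnegCone G) N) {i : l} {j : m} {k : n}
    (hij : M i j ≠ 0) (hjk : StrictlyPos (N j k)) : StrictlyPos ((M * N) i k) :=
  .sum (fun x _ => mul_mem (hM i x) (hN x k)) (Finset.mem_univ j) (hjk.mul_left (hM i j) hij)

variable [DecidableEq m] {K : Matrix m m (ZG G)}

theorem exists_pow_apply_ne_zero (hK : EntriesIn (nonnegCone G) K) {i j : m}
    (h : Relation.ReflTransGen (fun i j => K i j ≠ 0) i j) : ∃ p, (K ^ p) i j ≠ 0 := by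
  induction h with
  | refl => exact ⟨0, by simp⟩
  | tail _ h ih =>
    obtain ⟨p, hp⟩ := ih
    exact ⟨p + 1, pow_succ K p ▸ mul_apply_ne_zero (hK.pow p) hK hp h⟩

/- The lengths of the strictly positive loops at a vertex form an additive semigroup. -/
theorem exists_forall_strictlyPos_pow (hK : EntriesIn (nonnegCone G) K) {x : m} {s t : ℕ}
    (hst : s.Coprime t) (hs : StrictlyPos ((K ^ s) x x)) (ht : StrictlyPos ((K ^ t) x x)) :
    ∃ p₀, ∀ p ≥ p₀, StrictlyPos ((K ^ p) x x) := by
  have hclosure : ∀ p ∈ AddSubmonoid.closure {s, t}, p = 0 ∨ StrictlyPos ((K ^ p) x x) := by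
    intro p hp
    induction hp using AddSubmonoid.closure_induction with
    | mem p hp => rcases hp with rfl | rfl <;> exact .inr ‹_›
    | zero => exact .inl rfl
    | add p q _ _ hp hq =>
      rcases hp with rfl | hp
      · rwa [zero_add]
      rcases hq with rfl | hq
      · exact .inr hp
      · exact .inr (pow_add K p q ▸ hp.mul_apply_right (hK.pow p) (hK.pow q) hq.ne_zero)
  obtain ⟨p₀, hp₀⟩ := Nat.exists_mem_closure_of_ge {s, t}
  have hgcd : Nat.setGcd {s, t} = 1 := Nat.dvd_one.1 <| hst ▸ Nat.dvd_gcd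
    (Nat.setGcd_dvd_of_mem (by simp)) (Nat.setGcd_dvd_of_mem (by simp))
  exact ⟨p₀ + 1, fun p hp => (hclosure p (hp₀ p (by omega) (hgcd ▸ one_dvd p))).resolve_left
    (by omega)⟩

theorem GPrimitive.of_loops (hK : EntriesIn (nonnegCone G) K) {x : m} {s t : ℕ}
    (hst : s.Coprime t) (hs : StrictlyPos ((K ^ s) x x)) (ht : StrictlyPos ((K ^ t) x x))
    (hto : ∀ y, Relation.ReflTransGen (fun i j => K i j ≠ 0) y x)
    (hfrom : ∀ y, Relation.ReflTransGen (fun i j => K i j ≠ 0) x y) : GPrimitive K := by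
  obtain ⟨p₀, hp₀⟩ := exists_forall_strictlyPos_pow hK hst hs ht
  choose a ha using fun y => exists_pow_apply_ne_zero hK (hto y)
  choose b hb using fun y => exists_pow_apply_ne_zero hK (hfrom y)
  refine ⟨hK, ∑ y, a y + ∑ y, b y + p₀ + 1, by positivity, fun y z => ?_⟩
  have hy : a y ≤ ∑ y, a y := Finset.single_le_sum_of_canonicallyOrdered (Finset.mem_univ y)
  have hz : b z ≤ ∑ y, b y := Finset.single_le_sum_of_canonicallyOrdered (Finset.mem_univ z)
  obtain ⟨p, hp, hsum⟩ : ∃ p ≥ p₀, ∑ y, a y + ∑ y, b y + p₀ + 1 = a y + (p + b z) :=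
    ⟨∑ y, a y + ∑ y, b y + p₀ + 1 - a y - b z, by omega, by omega⟩
  rw [hsum, pow_add, pow_add]
  exact .mul_apply_left (hK.pow _) ((hK.pow _).mul (hK.pow _)) (ha y)
    ((hp₀ p hp).mul_apply_right (hK.pow _) (hK.pow _) (hb z))

end Primitivity

section PrimitiveBox

variable {G : Type*} [Group G] {m : Type*} [DecidableEq m] {B : Matrix m m (ZG G)[X]} {L : ℕ}

theorem polyCompanion_apply_top (h : 0 < L) (i j : m) (e : Fin L) :
    polyCompanion L B (⟨0, h⟩, i) (e, j) = (B i j).coeff (e + 1) := by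
  simp [polyCompanion, blockCompanion, coeffMatrix_apply]

theorem polyCompanion_apply_subdiagonal {b : ℕ} (h : b + 1 < L) (i : m) :
    polyCompanion L B (⟨b + 1, h⟩, i) (⟨b, by omega⟩, i) = 1 := by
  simp [polyCompanion, blockCompanion]

theorem reflTransGen_polyCompanion_of_le (i : m) {b c : ℕ} (hbc : b ≤ c) (hc : c < L) :
    Relation.ReflTransGen (fun x y => polyCompanion L B x y ≠ 0) (⟨c, hc⟩, i)
      (⟨b, by omega⟩, i) := by
  induction c, hbc using Nat.le_induction with
  | base => exact .refl
  | succ c hbc ih =>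
    exact (ih (by omega)).head (by rw [polyCompanion_apply_subdiagonal]; exact one_ne_zero)

variable [Fintype m]

theorem polyCompanion_pow_apply_ne_zero (hB : EntriesIn (polyOver (nonnegCone G)) B) (i : m)
    {c : ℕ} (hc : c < L) :
    (polyCompanion L B ^ c) (⟨c, hc⟩, i) (⟨0, by omega⟩, i) ≠ 0 := by
  have hK := hB.polyCompanion L
  induction c with
  | zero => simp
  | succ c ih =>
    rw [pow_succ']
    exact mul_apply_ne_zero hK (hK.pow c)
      (by rw [polyCompanion_apply_subdiagonal]; exact one_ne_zero) (ih (by omega))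

theorem strictlyPos_polyCompanion_pow (hB : EntriesIn (polyOver (nonnegCone G)) B) {i : m} {e : ℕ}
    (he : e < L) (h : StrictlyPos ((B i i).coeff (e + 1))) :
    StrictlyPos ((polyCompanion L B ^ (e + 1)) (⟨0, by omega⟩, i) (⟨0, by omega⟩, i)) := by
  have hK := hB.polyCompanion L
  rw [pow_succ']
  exact .mul_apply_right hK (hK.pow e) (j := (⟨e, he⟩, i))
    (by rwa [polyCompanion_apply_top]) (polyCompanion_pow_apply_ne_zero hB i he)

theorem reflTransGen_polyCompanion (hB : ∀ i j, (B i j).coeff 0 = 0) (hL : polyDegree B ≤ L)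
    (h0 : 0 < L) {i j : m} (h : Relation.ReflTransGen (fun i j => B i j ≠ 0) i j) :
    Relation.ReflTransGen (fun x y => polyCompanion L B x y ≠ 0) (⟨0, h0⟩, i) (⟨0, h0⟩, j) := by
  induction h with
  | refl => exact .refl
  | @tail j k _ hjk ih =>
    obtain ⟨e, he⟩ : ∃ e, (B j k).coeff e ≠ 0 := by
      by_contra! h0
      exact hjk (Polynomial.ext h0)
    obtain ⟨d, rfl⟩ : ∃ d, e = d + 1 :=
      Nat.exists_eq_succ_of_ne_zero fun h => he (h ▸ hB j k)
    have hd : d < L := by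
      by_contra! hd
      exact he (coeff_eq_zero_of_polyDegree_lt (by omega) j k)
    exact (ih.tail (by rwa [polyCompanion_apply_top h0 j k ⟨d, hd⟩])).trans
      (reflTransGen_polyCompanion_of_le k (Nat.zero_le d) hd)

theorem gprimitive_box (hB : EntriesIn (tPolyOver (nonnegCone G)) B) {i : m} {s t : ℕ}
    (hst : s.Coprime t) (hs : StrictlyPos ((B i i).coeff s)) (ht : StrictlyPos ((B i i).coeff t))
    (hto : ∀ j, Relation.ReflTransGen (fun i j => B i j ≠ 0) j i)
    (hfrom : ∀ j, (B i j).coeff (polyDegree B) ≠ 0) : GPrimitive (box B) := by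
  have hB' := hB.of_tPolyOver
  have h0 : 0 < polyDegree B := lt_of_lt_of_le one_pos (le_max_left _ _)
  have hloop : ∀ e, StrictlyPos ((B i i).coeff e) →
      StrictlyPos ((polyCompanion (polyDegree B) B ^ e) (⟨0, h0⟩, i) (⟨0, h0⟩, i)) := fun e he => by
    obtain ⟨d, rfl⟩ : ∃ d, e = d + 1 :=
      Nat.exists_eq_succ_of_ne_zero fun h => he.ne_zero (h ▸ (hB i i).1)
    refine strictlyPos_polyCompanion_pow hB' ?_ he
    by_contra! hd
    exact he.ne_zero (coeff_eq_zero_of_polyDegree_lt (by omega) i i)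
  rw [box_eq_polyCompanion]
  refine .of_loops (hB'.polyCompanion _) hst (hloop s hs) (hloop t ht) ?_ ?_
  · rintro ⟨⟨c, hc⟩, j⟩
    exact (reflTransGen_polyCompanion_of_le j (Nat.zero_le c) hc).trans
      (reflTransGen_polyCompanion (fun i j => (hB i j).1) le_rfl h0 (hto j))
  · rintro ⟨⟨c, hc⟩, j⟩
    refine .head (b := (⟨polyDegree B - 1, by omega⟩, j)) ?_
      (reflTransGen_polyCompanion_of_le j (by omega) _)
    rw [polyCompanion_apply_top, Nat.sub_add_cancel h0]
    exact hfrom j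

end PrimitiveBox

section Growth

theorem exists_eigenvector_of_lt_spectralRadius {n : Type*} [Fintype n] [DecidableEq n]
    (M : Matrix n n ℂ) {β : ℝ} (hβ0 : 0 ≤ β) (hβ : β < (spectralRadius ℂ M).toReal) :
    ∃ μ : ℂ, β < ‖μ‖ ∧ ∃ v ≠ 0, M.mulVec v = μ • v := by
  have hlt : ENNReal.ofReal β < spectralRadius ℂ M :=
    ENNReal.ofReal_lt_iff_lt_toReal hβ0 (fun htop => by simp [htop, hβ0.not_gt] at hβ) |>.2 hβ
  simp only [spectralRadius, lt_iSup_iff] at hlt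
  obtain ⟨μ, hμ, hlt⟩ := hlt
  refine ⟨μ, (ENNReal.ofReal_lt_ofReal_iff_of_nonneg hβ0).1 (by rwa [ofReal_norm]), ?_⟩
  rw [spectrum.mem_iff, Matrix.isUnit_iff_isUnit_det, isUnit_iff_ne_zero, not_not] at hμ
  obtain ⟨v, hv, h⟩ := Matrix.exists_mulVec_eq_zero_iff.2 hμ
  refine ⟨v, hv, Eq.symm ?_⟩
  rwa [Matrix.sub_mulVec, sub_eq_zero, Algebra.algebraMap_eq_smul_one, Matrix.smul_mulVec,
    Matrix.one_mulVec] at h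

/- The row is that of an entry of largest modulus of the eigenvector. -/
theorem exists_row_norm_le {n : Type*} [Fintype n] [DecidableEq n] {M : Matrix n n ℂ} {μ : ℂ}
    {v : n → ℂ} (hv : v ≠ 0) (h : M.mulVec v = μ • v) :
    ∃ i, ∀ s : ℕ, ‖μ‖ ^ s ≤ ∑ j, ‖(M ^ s) i j‖ := by
  obtain ⟨x, hx⟩ := Function.ne_iff.1 hv
  obtain ⟨i, -, hi⟩ := Finset.exists_max_image Finset.univ (fun i => ‖v i‖) ⟨x, Finset.mem_univ x⟩
  have hvi : 0 < ‖v i‖ := (norm_pos_iff.2 hx).trans_le (hi x (Finset.mem_univ x))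
  refine ⟨i, fun s => ?_⟩
  have hs : (M ^ s).mulVec v = μ ^ s • v := by
    induction s with
    | zero => simp
    | succ s ih =>
      rw [pow_succ, ← Matrix.mulVec_mulVec, h, Matrix.mulVec_smul, ih, smul_smul, pow_succ,
        mul_comm]
  refine le_of_mul_le_mul_right ?_ hvi
  calc ‖μ‖ ^ s * ‖v i‖ = ‖((M ^ s).mulVec v) i‖ := by rw [hs]; simp
    _ ≤ ∑ j, ‖(M ^ s) i j‖ * ‖v j‖ := (norm_sum_le _ _).trans_eq (by simp only [norm_mul])
    _ ≤ ∑ j, ‖(M ^ s) i j‖ * ‖v i‖ := Finset.sum_le_sum fun j _ =>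
        mul_le_mul_of_nonneg_left (hi j (Finset.mem_univ j)) (norm_nonneg _)
    _ = (∑ j, ‖(M ^ s) i j‖) * ‖v i‖ := (Finset.sum_mul ..).symm

variable {G : Type*} [Group G] {n : Type*} [Fintype n]

theorem coeff_mul_le_coeff_mul_apply {M N : Matrix n n (ZG G)} (hM : EntriesIn (nonnegCone G) M)
    (hN : EntriesIn (nonnegCone G) N) (i l j : n) (g : G) :
    (M i l * N l j).coeff g ≤ ((M * N) i j).coeff g := by
  rw [Matrix.mul_apply, coeff_sum_apply]
  exact Finset.single_le_sum (f := fun l => (M i l * N l j).coeff g)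
    (fun l _ => mul_mem (hM i l) (hN l j) g) (Finset.mem_univ l)

variable [DecidableEq n] {A : Matrix n n (ZG G)}

theorem exists_row_pow_le_sum_aug (hA : EntriesIn (nonnegCone G) A) {β : ℝ} (hβ0 : 0 ≤ β)
    (hβ : β < specRadius A) :
    ∃ μ, β < μ ∧ ∃ i, ∀ s : ℕ, μ ^ s ≤ ∑ j, (aug ((A ^ s) i j) : ℝ) := by
  obtain ⟨μ, hμ, v, hv, hAv⟩ := exists_eigenvector_of_lt_spectralRadius _ hβ0 hβ
  obtain ⟨i, hi⟩ := exists_row_norm_le hv hAv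
  refine ⟨‖μ‖, hμ, i, fun s => (hi s).trans_eq (Finset.sum_congr rfl fun j _ => ?_)⟩
  have hmap : (A.map fun x => ((aug x : ℤ) : ℂ)) ^ s =
      (A ^ s).map ((Int.castRingHom ℂ).comp aug) := by
    rw [Matrix.map_pow]
    rfl
  have hnorm : ‖((Int.castRingHom ℂ).comp aug) ((A ^ s) i j)‖ = |(aug ((A ^ s) i j) : ℝ)| := by
    simp
  rw [hmap, Matrix.map_apply, hnorm, abs_of_nonneg (Int.cast_nonneg (aug_nonneg (hA.pow s i j)))]

/- Any path of length `s` is extended by `p` edges on either side. -/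
theorem sum_aug_le_coeff_pow (hA : EntriesIn (nonnegCone G) A) {p : ℕ}
    (hp : ∀ i j, StrictlyPos ((A ^ p) i j)) (s : ℕ) (a i j : n) (g : G) :
    ∑ l, aug ((A ^ s) a l) ≤ ((A ^ (p + (s + p))) i j).coeff g := by
  have hpow := hA.pow
  have hright : ∑ l, aug ((A ^ s) a l) ≤ aug ((A ^ (s + p)) a j) := by
    rw [pow_add, Matrix.mul_apply, map_sum]
    refine Finset.sum_le_sum fun l _ => ?_
    rw [map_mul]
    exact le_mul_of_one_le_right (aug_nonneg (hpow s a l)) (aug_pos (hpow p l j) (hp l j).ne_zero)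
  have hleft : aug ((A ^ (s + p)) a j) ≤ ((A ^ p) i a * (A ^ (s + p)) a j).coeff g := by
    have h := mul_aug_le_coeff_mul (c := 1) (x := (A ^ p) i a)
      (fun g => Int.cast_one_le_of_pos (hp i a g)) (hpow (s + p) a j) g
    rw [one_mul] at h
    exact_mod_cast h
  exact (hright.trans hleft).trans
    (pow_add A p (s + p) ▸ coeff_mul_le_coeff_mul_apply (hpow p) (hpow (s + p)) i a j g)

theorem exists_pow_le_of_shifted {γ μ : ℝ} (hγ : 0 < γ) (hγμ : γ < μ) (q : ℕ) :
    ∃ m₀, ∀ s, m₀ ≤ s + q → γ ^ (s + q) ≤ μ ^ s := by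
  have hμ : 0 < μ := hγ.trans hγμ
  obtain ⟨m₀, hm₀⟩ := Filter.eventually_atTop.1
    ((tendsto_pow_atTop_atTop_of_one_lt ((one_lt_div hγ).2 hγμ)).eventually_ge_atTop (μ ^ q))
  refine ⟨m₀, fun s hs => ?_⟩
  have h := hm₀ _ hs
  rw [div_pow, le_div_iff₀ (by positivity), pow_add μ, mul_comm (μ ^ s)] at h
  exact le_of_mul_le_mul_left h (by positivity)

theorem GPrimitive.exists_growth (hA : GPrimitive A) {β : ℝ} (hβ0 : 0 < β)
    (hβ : β < specRadius A) : ∃ γ, β < γ ∧ ∃ m₀ : ℕ, ∀ s, m₀ ≤ s → ∀ i j g,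
      γ ^ s ≤ (((A ^ s) i j).coeff g : ℝ) := by
  obtain ⟨hnn, p, -, hp⟩ := hA
  obtain ⟨μ, hμ, a, ha⟩ := exists_row_pow_le_sum_aug hnn hβ0.le hβ
  obtain ⟨γ, hβγ, hγμ⟩ := exists_between hμ
  obtain ⟨m₀, hm₀⟩ := exists_pow_le_of_shifted (hβ0.trans hβγ) hγμ (2 * p)
  refine ⟨γ, hβγ, max m₀ (2 * p), fun s hs i j g => ?_⟩
  obtain ⟨t, rfl⟩ : ∃ t, s = t + 2 * p := ⟨s - 2 * p, by omega⟩
  refine (hm₀ t ((le_max_left _ _).trans hs)).trans ((ha t).trans ?_)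
  have hcoeff := sum_aug_le_coeff_pow hnn hp t a i j g
  rw [show t + 2 * p = p + (t + p) by omega]
  exact_mod_cast hcoeff

end Growth

section Paths

variable {R : Type*} [Ring R] {n : Type*} [Fintype n] [DecidableEq n]

/- The paths are cut at their last visit to `i₀`. -/
theorem pow_eq_sum_firstPass (A : Matrix n n R) (i₀ : n) (s : ℕ) (j : n) :
    (A ^ (s + 1)) i₀ j = ∑ m ∈ Finset.range (s + 1), (A ^ m) i₀ i₀ * firstPass A i₀ (s - m) j := by
  induction s generalizing j with
  | zero => simp [firstPass]
  | succ s ih =>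
    have hstep : ∀ m ∈ Finset.range (s + 1),
        (A ^ m) i₀ i₀ * firstPass A i₀ (s + 1 - m) j =
          ∑ l, if l = i₀ then 0 else (A ^ m) i₀ i₀ * firstPass A i₀ (s - m) l * A l j := by
      intro m hm
      rw [Nat.succ_sub (Nat.lt_succ_iff.1 (Finset.mem_range.1 hm)), firstPass, Finset.mul_sum]
      exact Finset.sum_congr rfl fun l _ => by rw [mul_ite, mul_zero, mul_assoc]
    rw [Finset.sum_range_succ, Finset.sum_congr rfl hstep, Finset.sum_comm, Nat.sub_self, firstPass,
      pow_succ, Matrix.mul_apply, ← Finset.sum_erase_add _ _ (Finset.mem_univ i₀)]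
    congr 1
    rw [← Finset.sum_erase_add _ _ (Finset.mem_univ i₀)]
    simp only [if_true, Finset.sum_const_zero, add_zero]
    refine Finset.sum_congr rfl fun l hl => ?_
    simp only [if_neg (Finset.ne_of_mem_erase hl), ih l, Finset.sum_mul]

/-- The total weight of the paths from `i₀` to `j` of length `s` in the graph in which the
coefficient of `t ^ e` in `C i j` weighs an edge from `i` to `j` of length `e`. It is the
coefficient of `t ^ s` in the entry at `(i₀, j)` of the power series `(1 - C)⁻¹`. -/
def pathSum (C : Matrix n n R[X]) (i₀ : n) : ℕ → n → R
  | 0 => Pi.single i₀ 1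
  | s + 1 => fun j => ∑ m : Fin (s + 1), ∑ l, pathSum C i₀ m l * (C l j).coeff (s - m + 1)

theorem pathSum_zero (C : Matrix n n R[X]) (i₀ : n) : pathSum C i₀ 0 = Pi.single i₀ 1 := by
  rw [pathSum]

theorem pathSum_succ (C : Matrix n n R[X]) (i₀ : n) (s : ℕ) (j : n) : pathSum C i₀ (s + 1) j =
    ∑ m ∈ Finset.range (s + 1), ∑ l, pathSum C i₀ m l * (C l j).coeff (s - m + 1) := by
  rw [pathSum]
  exact Fin.sum_univ_eq_sum_range
    (fun m => ∑ l, pathSum C i₀ m l * (C l j).coeff (s - m + 1)) (s + 1)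

variable {P : Subsemiring R} {C : Matrix n n R[X]}

theorem pathSum_mem (hC : EntriesIn (polyOver P) C) (i₀ : n) (s : ℕ) (j : n) :
    pathSum C i₀ s j ∈ P := by
  induction s using Nat.strong_induction_on generalizing j with
  | _ s ih =>
    cases s with
    | zero =>
      rw [pathSum_zero, Pi.single_apply]
      split_ifs
      exacts [one_mem P, zero_mem P]
    | succ s =>
      rw [pathSum_succ]
      exact sum_mem fun m hm => sum_mem fun l _ =>
        mul_mem (ih m (Finset.mem_range.1 hm) l) (hC l j _)

theorem pathSum_add_sub_mul_mem (hC : EntriesIn (polyOver P) C) (i₀ : n) (m t : ℕ) (j : n) :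
    pathSum C i₀ (m + t) j - pathSum C i₀ m i₀ * pathSum C i₀ t j ∈ P := by
  induction t using Nat.strong_induction_on generalizing j with
  | _ t ih =>
    cases t with
    | zero =>
      rw [pathSum_zero, add_zero]
      by_cases h : j = i₀
      · rw [h, Pi.single_eq_same, mul_one, sub_self]
        exact zero_mem P
      · rw [Pi.single_eq_of_ne h, mul_zero, sub_zero]
        exact pathSum_mem hC _ _ _
    | succ t =>
      rw [← add_assoc, pathSum_succ, pathSum_succ, add_assoc m t 1, Finset.sum_range_add,
        add_sub_assoc, Finset.mul_sum, ← Finset.sum_sub_distrib]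
      refine add_mem (sum_mem fun e _ => sum_mem fun l _ =>
        mul_mem (pathSum_mem hC _ _ _) (hC l j _)) (sum_mem fun e he => ?_)
      rw [Finset.mul_sum, ← Finset.sum_sub_distrib]
      refine sum_mem fun l _ => ?_
      rw [Nat.add_sub_add_left, ← mul_assoc, ← sub_mul]
      exact mul_mem (ih e (Finset.mem_range.1 he) l) (hC l j _)

end Paths

section RowExpansion

variable {R : Type*} [Ring R] {n : Type*} [Fintype n] [DecidableEq n]

/-- `C` agrees with `expandRow A i₀ q` except perhaps in the loops at `i₀`, whose lengths are
positive and at most `q + 1`. -/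
structure IsRowExpansion (A : Matrix n n R) (i₀ : n) (q : ℕ) (C : Matrix n n R[X]) : Prop where
  apply_of_ne : ∀ {i} j, i ≠ i₀ → C i j = monomial 1 (A i j)
  apply_exit : ∀ {j}, j ≠ i₀ → C i₀ j = monomial (q + 1) (firstPass A i₀ q j)
  coeff_loop_zero : (C i₀ i₀).coeff 0 = 0
  coeff_loop_eq_zero : ∀ {e}, q + 1 < e → (C i₀ i₀).coeff e = 0

variable {A : Matrix n n R} {i₀ : n} {q : ℕ} {C : Matrix n n R[X]}

namespace IsRowExpansion

theorem coeff_zero (hC : IsRowExpansion A i₀ q C) (i j : n) : (C i j).coeff 0 = 0 := by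
  by_cases hi : i = i₀
  · by_cases hj : j = i₀
    · rw [hi, hj, hC.coeff_loop_zero]
    · rw [hi, hC.apply_exit hj, coeff_monomial_of_ne _ (Nat.succ_ne_zero q).symm]
  · rw [hC.apply_of_ne j hi, coeff_monomial_of_ne _ zero_ne_one]

theorem coeff_eq_zero (hC : IsRowExpansion A i₀ q C) (i j : n) {e : ℕ} (he : q + 1 < e) :
    (C i j).coeff e = 0 := by
  by_cases hi : i = i₀
  · by_cases hj : j = i₀
    · rw [hi, hj, hC.coeff_loop_eq_zero he]
    · rw [hi, hC.apply_exit hj, coeff_monomial_of_ne _ he.ne']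
  · rw [hC.apply_of_ne j hi, coeff_monomial_of_ne _ (by omega)]

theorem pathSum_eq_zero (hC : IsRowExpansion A i₀ q C) {s : ℕ} (hs : s ≤ q) {j : n} (hj : j ≠ i₀) :
    pathSum C i₀ s j = 0 := by
  induction s using Nat.strong_induction_on generalizing j with
  | _ s ih =>
    cases s with
    | zero => rw [pathSum_zero, Pi.single_eq_of_ne hj]
    | succ s =>
      rw [pathSum_succ]
      refine Finset.sum_eq_zero fun m hm => Finset.sum_eq_zero fun l _ => ?_
      have hms := Finset.mem_range.1 hm
      by_cases hl : l = i₀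
      · rw [hl, hC.apply_exit hj, coeff_monomial_of_ne _ (by omega), mul_zero]
      · rw [ih m hms (by omega) hl, zero_mul]

theorem pathSum_eq_pow (hC : IsRowExpansion A i₀ q C) {σ : ℕ}
    (hloop : ∀ e < σ, (C i₀ i₀).coeff (e + 1) = firstPass A i₀ e i₀) (hσ : σ ≤ q) {s : ℕ}
    (hs : s ≤ σ) : pathSum C i₀ s i₀ = (A ^ s) i₀ i₀ := by
  induction s using Nat.strong_induction_on with
  | _ s ih =>
    cases s with
    | zero => rw [pathSum_zero, Pi.single_eq_same, pow_zero, Matrix.one_apply_eq]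
    | succ s =>
      rw [pathSum_succ, pow_eq_sum_firstPass]
      refine Finset.sum_congr rfl fun m hm => ?_
      have hms := Finset.mem_range.1 hm
      rw [Fintype.sum_eq_single i₀, ih m hms (by omega), hloop _ (by omega)]
      intro l hl
      rw [hC.pathSum_eq_zero (by omega) hl, zero_mul]

variable {P : Subsemiring R}

theorem pathSum_sub_firstPass_mem (hC : IsRowExpansion A i₀ q C) (hCP : EntriesIn (polyOver P) C)
    (hA : EntriesIn P A) (r : ℕ) {j : n} (hj : j ≠ i₀) :
    pathSum C i₀ (q + r + 1) j - firstPass A i₀ (q + r) j ∈ P := by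
  have hmem : ∀ m l e, pathSum C i₀ m l * (C l j).coeff e ∈ P := fun m l e =>
    mul_mem (pathSum_mem hCP i₀ m l) (hCP l j e)
  induction r generalizing j with
  | zero =>
    rw [add_zero, pathSum_succ, Finset.sum_range_succ', Nat.sub_zero, add_sub_assoc]
    refine add_mem (sum_mem fun m _ => sum_mem fun l _ => hmem _ _ _) ?_
    rw [Fintype.sum_eq_single i₀ fun l hl => by rw [pathSum_zero, Pi.single_eq_of_ne hl, zero_mul],
      pathSum_zero, Pi.single_eq_same, one_mul, hC.apply_exit hj, coeff_monomial_same, sub_self]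
    exact zero_mem P
  | succ r ih =>
    rw [pathSum_succ, Finset.sum_range_succ, Nat.sub_self, add_sub_assoc]
    refine add_mem (sum_mem fun m _ => sum_mem fun l _ => hmem _ _ _) ?_
    rw [← add_assoc, firstPass, ← Finset.sum_sub_distrib]
    refine sum_mem fun l _ => ?_
    split_ifs with hl
    · rw [sub_zero]
      exact hmem _ _ _
    · rw [hC.apply_of_ne j hl, coeff_monomial_same, ← sub_mul]
      exact mul_mem (ih hl fun m x e => mul_mem (pathSum_mem hCP i₀ m x) (hCP x l e)) (hA l j)

end IsRowExpansion

end RowExpansion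

section GroupRingPaths

variable {G : Type*} [Group G] {n : Type*} [Fintype n] [DecidableEq n]

theorem coeff_le_coeff_of_sub_mem {x y : ZG G} (h : x - y ∈ nonnegCone G) (g : G) :
    (y.coeff g : ℝ) ≤ x.coeff g := by
  have hg := h g
  rw [MonoidAlgebra.coeff_sub, Finsupp.sub_apply, sub_nonneg] at hg
  exact_mod_cast hg

theorem exists_injective_of_forall_exists_eq_zero {A : Matrix n n (ZG G)} {p : ℕ} (hp : 0 < p)
    (hpos : ∀ i j, StrictlyPos ((A ^ p) i j)) {f : n → n} (hf : ∀ i l, l ≠ i → A l (f i) = 0) :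
    Function.Injective f := by
  have hcol : ∀ j, ∃ l, A l j ≠ 0 := fun j => by
    by_contra! hzero
    refine (hpos j j).ne_zero ?_
    rw [← Nat.succ_pred_eq_of_pos hp, pow_succ, Matrix.mul_apply]
    exact Finset.sum_eq_zero fun l _ => by rw [hzero l, mul_zero]
  intro i i' h
  obtain ⟨l, hl⟩ := hcol (f i)
  have hli : l = i := not_imp_comm.1 (hf i l) hl
  have hli' : l = i' := not_imp_comm.1 (hf i' l) (h ▸ hl)
  exact hli.symm.trans hli'

theorem eq_iterate_of_pow_apply_ne_zero {A : Matrix n n (ZG G)} {g : n → n}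
    (hg : ∀ l j, A l j ≠ 0 → l = g j) {q : ℕ} {l j : n} (h : (A ^ q) l j ≠ 0) : l = g^[q] j := by
  induction q generalizing j with
  | zero =>
    by_contra hne
    exact h (by rw [pow_zero]; exact Matrix.one_apply_ne hne)
  | succ q ih =>
    rw [pow_succ, Matrix.mul_apply] at h
    obtain ⟨x, -, hx⟩ := Finset.exists_ne_zero_of_sum_ne_zero h
    rw [Function.iterate_succ_apply, ← hg x j (right_ne_zero_of_mul hx)]
    exact ih (left_ne_zero_of_mul hx)

/- Otherwise the predecessors would be unique, and `A` would be a weighted permutation matrix. -/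
theorem GPrimitive.exists_forall_exists_ne [Nontrivial n] {A : Matrix n n (ZG G)}
    (hA : GPrimitive A) : ∃ i₀, ∀ j, ∃ l, l ≠ i₀ ∧ A l j ≠ 0 := by
  obtain ⟨-, p, hp, hpos⟩ := hA
  by_contra! hunique
  choose f hf using hunique
  have hinj := exists_injective_of_forall_exists_eq_zero hp hpos hf
  obtain ⟨g, hg⟩ := (Finite.surjective_of_injective hinj).hasRightInverse
  have hpred : ∀ l j, A l j ≠ 0 → l = g j := fun l j h => by
    by_contra hne
    exact h (hg j ▸ hf (g j) l hne)
  obtain ⟨x, y, hxy⟩ := exists_pair_ne n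
  exact hxy ((eq_iterate_of_pow_apply_ne_zero hpred (hpos x x).ne_zero).trans
    (eq_iterate_of_pow_apply_ne_zero hpred (hpos y x).ne_zero).symm)

theorem GPrimitive.exists_firstPass_ne_zero {A : Matrix n n (ZG G)} (hA : GPrimitive A) {i₀ : n}
    (hi₀ : ∀ j, ∃ l, l ≠ i₀ ∧ A l j ≠ 0) (E : ℕ) (j : n) :
    ∃ e, E ≤ e ∧ firstPass A i₀ e j ≠ 0 := by
  obtain ⟨hnn, p, hp, hpos⟩ := hA
  have hfp := firstPass_mem (P := nonnegCone G) hnn i₀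
  induction E generalizing j with
  | zero =>
    have h := (hpos i₀ j).ne_zero
    rw [← Nat.succ_pred_eq_of_pos hp, Nat.succ_eq_add_one, pow_eq_sum_firstPass] at h
    obtain ⟨m, -, hm⟩ := Finset.exists_ne_zero_of_sum_ne_zero h
    exact ⟨_, Nat.zero_le _, right_ne_zero_of_mul hm⟩
  | succ E ih =>
    obtain ⟨l, hl, hlj⟩ := hi₀ j
    obtain ⟨e, he, h⟩ := ih l
    refine ⟨e + 1, Nat.succ_le_succ he, sum_ne_zero_of_mem (fun x _ => ?_) (Finset.mem_univ l) ?_⟩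
    · split_ifs
      exacts [zero_mem _, mul_mem (hfp e x) (hnn x j)]
    · rw [if_neg hl]
      exact mul_ne_zero_of_mem (hfp e l) (hnn l j) h hlj

variable {C : Matrix n n (ZG G)[X]} {i₀ : n} {γ : ℝ}

theorem pow_mul_aug_le_coeff_pathSum (hC : EntriesIn (polyOver (nonnegCone G)) C) {m : ℕ}
    (h : ∀ g, γ ^ m ≤ ((pathSum C i₀ m i₀).coeff g : ℝ)) (t : ℕ) (j : n) (g : G) :
    γ ^ m * aug (pathSum C i₀ t j) ≤ ((pathSum C i₀ (m + t) j).coeff g : ℝ) :=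
  (mul_aug_le_coeff_mul h (pathSum_mem hC i₀ t j) g).trans
    (coeff_le_coeff_of_sub_mem (pathSum_add_sub_mul_mem hC i₀ m t j) g)

/- A path longer than `2 * m₀` dominates the product of its parts of lengths `m₀` and `s - m₀`. -/
theorem pow_le_coeff_pathSum (hC : EntriesIn (polyOver (nonnegCone G)) C) (hγ : 0 < γ) {m₀ : ℕ}
    (hm₀ : 0 < m₀)
    (h : ∀ s, m₀ ≤ s → s ≤ 2 * m₀ → ∀ g, γ ^ s ≤ ((pathSum C i₀ s i₀).coeff g : ℝ)) {s : ℕ}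
    (hs : m₀ ≤ s) (g : G) : γ ^ s ≤ ((pathSum C i₀ s i₀).coeff g : ℝ) := by
  induction s using Nat.strong_induction_on generalizing g with
  | _ s ih =>
    rcases le_or_gt s (2 * m₀) with hs2 | hs2
    · exact h s hs hs2 g
    · obtain ⟨t, rfl⟩ := Nat.exists_eq_add_of_le hs
      have ht : γ ^ t ≤ (aug (pathSum C i₀ t i₀) : ℝ) :=
        (ih t (by omega) (by omega) 1).trans
          (Int.cast_le.2 (coeff_le_aug (pathSum_mem hC i₀ t i₀) 1))
      calc γ ^ (m₀ + t) ≤ γ ^ m₀ * aug (pathSum C i₀ t i₀) := by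
            rw [pow_add]
            exact mul_le_mul_of_nonneg_left ht (pow_nonneg hγ.le _)
        _ ≤ _ := pow_mul_aug_le_coeff_pathSum hC (h m₀ le_rfl (by omega)) t i₀ g

theorem IsRowExpansion.exists_pathSum_ne_zero {A : Matrix n n (ZG G)} {q : ℕ}
    (hC : IsRowExpansion A i₀ q C) (hCP : EntriesIn (polyOver (nonnegCone G)) C)
    (hA : GPrimitive A) (hi₀ : ∀ j, ∃ l, l ≠ i₀ ∧ A l j ≠ 0) (j : n) :
    ∃ t, pathSum C i₀ t j ≠ 0 := by
  by_cases hj : j = i₀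
  · exact ⟨0, by rw [pathSum_zero, hj, Pi.single_eq_same]; exact one_ne_zero⟩
  · obtain ⟨e, he, h⟩ := hA.exists_firstPass_ne_zero hi₀ q j
    obtain ⟨r, rfl⟩ := Nat.exists_eq_add_of_le he
    obtain ⟨g, hg⟩ := exists_coeff_pos (firstPass_mem (P := nonnegCone G) hA.1 i₀ (q + r) j) h
    refine ⟨q + r + 1, fun h0 => ?_⟩
    have hle := hC.pathSum_sub_firstPass_mem hCP hA.1 r hj g
    rw [h0, zero_sub, MonoidAlgebra.coeff_neg, Finsupp.neg_apply] at hle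
    omega

end GroupRingPaths

section Loops

variable {R : Type*} [Ring R] {k l n : Type*} [DecidableEq n]

/-- The edges from the new vertices to `i₀` with weighted lengths given by `y`. -/
def startEdges (i₀ : n) (y : k → R[X]) : Matrix k n R[X] :=
  Matrix.of fun a j => if j = i₀ then y a else 0

/-- The matrix whose row `i₀` is constant `1` and whose other rows vanish: one edge from `i₀` to
each new vertex in `k`. -/
def rowOnes (k : Type*) (i₀ : n) : Matrix n k R := Matrix.of fun i _ => if i = i₀ then 1 else 0

theorem coeff_startEdges (i₀ : n) (y : k → R[X]) (a : k) (j : n) (e : ℕ) :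
    (startEdges i₀ y a j).coeff e = if j = i₀ then (y a).coeff e else 0 := by
  by_cases hj : j = i₀ <;> simp [startEdges, hj]

theorem mul_startEdges [Fintype k] (M : Matrix l k R[X]) (i₀ : n) (y : k → R[X]) :
    M * startEdges i₀ y = startEdges i₀ (M.mulVec y) := by
  ext1 i j
  by_cases hj : j = i₀ <;> simp [Matrix.mul_apply, startEdges, Matrix.mulVec, dotProduct, hj]

theorem mul_rowOnes_apply [Fintype n] (M : Matrix l n R[X]) (i₀ : n) (i : l) (a : k) :
    (M * (rowOnes k i₀ : Matrix n k R).map Polynomial.C) i a = M i i₀ := by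
  rw [Matrix.mul_apply, Fintype.sum_eq_single i₀ fun j hj => by simp [rowOnes, hj]]
  simp [rowOnes]

variable [Fintype k] [Fintype n]

/-- The matrix `expandRow A i₀ q` after deletion of the loops at `i₀` of lengths `s a + 1` and
weights `x a`. -/
def deleteLoops (A : Matrix n n R) (i₀ : n) (q : ℕ) (s : k → ℕ) (x : k → R) : Matrix n n R[X] :=
  expandRow A i₀ q - (rowOnes k i₀ : Matrix n k R).map Polynomial.C *
    startEdges i₀ fun a => monomial (s a + 1) (x a)

variable {A : Matrix n n R} {i₀ : n} {q : ℕ} {s : k → ℕ} {x : k → R}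

theorem deleteLoops_apply (i j : n) : deleteLoops A i₀ q s x i j = expandRow A i₀ q i j -
    if i = i₀ ∧ j = i₀ then ∑ a, monomial (s a + 1) (x a) else 0 := by
  rw [deleteLoops, Matrix.sub_apply, mul_startEdges]
  by_cases hi : i = i₀ <;> simp [startEdges, rowOnes, Matrix.mulVec, dotProduct, hi]

theorem coeff_deleteLoops_succ (e : ℕ) :
    (deleteLoops A i₀ q s x i₀ i₀).coeff (e + 1) =
      (if e ≤ q then firstPass A i₀ e i₀ else 0) - ∑ a, if s a = e then x a else 0 := by
  simp [deleteLoops_apply, expandRow, expandRowLoops, expandRowExit, coeff_monomial]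

theorem isRowExpansion_deleteLoops (hs : ∀ a, s a ≤ q) :
    IsRowExpansion A i₀ q (deleteLoops A i₀ q s x) where
  apply_of_ne j hi := by
    simp [deleteLoops_apply, expandRow, expandRowLoops, expandRowExit, hi]
  apply_exit hj := by
    simp [deleteLoops_apply, expandRow, expandRowLoops, expandRowExit, hj]
  coeff_loop_zero := by
    simp [deleteLoops_apply, expandRow, expandRowLoops, expandRowExit, coeff_monomial]
  coeff_loop_eq_zero {e} he := by
    obtain ⟨e, rfl⟩ : ∃ c, e = c + 1 := ⟨e - 1, by omega⟩
    have hne : ∀ a, s a ≠ e := fun a => ((hs a).trans_lt (Nat.lt_of_succ_lt_succ he)).ne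
    simp [coeff_deleteLoops_succ, hne, Nat.lt_of_succ_lt_succ he]

theorem coeff_deleteLoops_of_lt {σ : ℕ} (hσ : ∀ a, σ ≤ s a) (hσq : σ ≤ q) {e : ℕ} (he : e < σ) :
    (deleteLoops A i₀ q s x i₀ i₀).coeff (e + 1) = firstPass A i₀ e i₀ := by
  rw [coeff_deleteLoops_succ, if_pos (he.le.trans hσq),
    Finset.sum_eq_zero fun a _ => if_neg (he.trans_le (hσ a)).ne', sub_zero]

theorem EntriesIn.deleteLoops {P : Subsemiring R} (hA : EntriesIn P A)
    (hs : Function.Injective s) (hsq : ∀ a, s a ≤ q)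
    (hx : ∀ a, firstPass A i₀ (s a) i₀ - x a ∈ P) :
    EntriesIn (tPolyOver P) (deleteLoops A i₀ q s x) := fun i j => by
  have hC := isRowExpansion_deleteLoops (A := A) (i₀ := i₀) (x := x) hsq
  by_cases hi : i = i₀
  · by_cases hj : j = i₀
    · subst hi hj
      refine ⟨hC.coeff_loop_zero, fun e => ?_⟩
      rcases e with - | e
      · exact hC.coeff_loop_zero ▸ zero_mem P
      · rw [coeff_deleteLoops_succ]
        by_cases h : ∃ a, s a = e
        · obtain ⟨a, rfl⟩ := h
          rw [if_pos (hsq a), Fintype.sum_eq_single a fun b hb => if_neg fun h => hb (hs h),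
            if_pos rfl]
          exact hx a
        · push Not at h
          rw [Finset.sum_eq_zero fun a _ => if_neg (h a), sub_zero]
          split_ifs
          exacts [firstPass_mem hA j e j, zero_mem P]
    · rw [hi, hC.apply_exit hj]
      exact monomial_mem_tPolyOver q.succ_ne_zero (firstPass_mem hA i₀ q j)
  · rw [hC.apply_of_ne j hi]
    exact monomial_mem_tPolyOver one_ne_zero (hA i j)

end Loops

section GroupRingLoops

variable {G : Type*} [Group G]

theorem sub_single_mem_nonnegCone {x : ZG G} (hx : x ∈ nonnegCone G) {g : G}
    (hg : 0 < x.coeff g) : x - MonoidAlgebra.single g 1 ∈ nonnegCone G := fun h => by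
  classical
  rw [MonoidAlgebra.coeff_sub, Finsupp.sub_apply, MonoidAlgebra.coeff_single,
    Finsupp.single_apply]
  split_ifs with hgh
  · exact hgh ▸ sub_nonneg.2 hg
  · exact (sub_zero (x.coeff h)).symm ▸ hx h

theorem GPrimitive.exists_loops {n : Type*} [Fintype n] [DecidableEq n] {A : Matrix n n (ZG G)}
    (hA : GPrimitive A) {i₀ : n} (hi₀ : ∀ j, ∃ l, l ≠ i₀ ∧ A l j ≠ 0) (k E : ℕ) :
    ∃ (s : Fin k → ℕ) (g : Fin k → G), Function.Injective s ∧ (∀ a, E ≤ s a) ∧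
      ∀ a, 0 < (firstPass A i₀ (s a) i₀).coeff (g a) := by
  have hinf : {e | E ≤ e ∧ firstPass A i₀ e i₀ ≠ 0}.Infinite := by
    refine Set.infinite_of_forall_exists_gt fun b => ?_
    obtain ⟨e, he, h⟩ := hA.exists_firstPass_ne_zero hi₀ (E + b + 1) i₀
    exact ⟨e, ⟨by omega, h⟩, by omega⟩
  let f := hinf.natEmbedding
  choose g hg using fun a : Fin k =>
    exists_coeff_pos (firstPass_mem (P := nonnegCone G) hA.1 i₀ (f a : ℕ) i₀) (f a).2.2
  exact ⟨fun a => f a, g, fun a b h => Fin.val_injective (f.injective (Subtype.val_injective h)),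
    fun a => (f a).2.1, hg⟩

end GroupRingLoops

section PathSeries

variable {R : Type*} [Ring R] {n : Type*} [Fintype n] [DecidableEq n]

/-- The generating series of the paths from `i₀` to `j`, preceded by an edge to `i₀` whose weighted
lengths are given by `y`. -/
def pathSeries (C : Matrix n n R[X]) (i₀ : n) (y : R[X]) (j : n) : PowerSeries R :=
  y * PowerSeries.mk fun s => pathSum C i₀ s j

variable {C : Matrix n n R[X]}

theorem mk_pathSum_eq (hC : ∀ i j, (C i j).coeff 0 = 0) (i₀ j : n) :
    PowerSeries.mk (fun s => pathSum C i₀ s j) = (if j = i₀ then 1 else 0) +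
      ∑ l, PowerSeries.mk (fun s => pathSum C i₀ s l) * (C l j : PowerSeries R) := by
  ext s
  rw [PowerSeries.coeff_mk, map_add, map_sum]
  simp only [PowerSeries.coeff_mul, PowerSeries.coeff_mk, coeff_coe]
  cases s with
  | zero =>
    by_cases hj : j = i₀ <;> simp [pathSum_zero, hC, hj]
  | succ s =>
    have hδ : PowerSeries.coeff (s + 1) (if j = i₀ then 1 else 0 : PowerSeries R) = 0 := by
      split_ifs <;> simp [PowerSeries.coeff_one]
    rw [pathSum_succ, hδ, zero_add, Finset.sum_comm]
    refine Finset.sum_congr rfl fun l _ => ?_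
    rw [Finset.Nat.sum_antidiagonal_succ', hC, mul_zero, zero_add,
      Finset.Nat.sum_antidiagonal_eq_sum_range_succ_mk]

theorem pathSeries_eq (hC : ∀ i j, (C i j).coeff 0 = 0) (i₀ : n) (y : R[X]) (j : n) :
    pathSeries C i₀ y j = (if j = i₀ then (y : PowerSeries R) else 0) +
      ∑ l, pathSeries C i₀ y l * (C l j : PowerSeries R) := by
  rw [pathSeries, mk_pathSum_eq hC, mul_add, mul_ite, mul_one, mul_zero, Finset.mul_sum]
  simp only [pathSeries, mul_assoc]

theorem coeff_pathSeries_monomial (C : Matrix n n R[X]) (i₀ : n) (c : ℕ) (x : R) (j : n) (t : ℕ) :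
    PowerSeries.coeff t (pathSeries C i₀ (monomial (c + 1) x) j) =
      if c < t then x * pathSum C i₀ (t - (c + 1)) j else 0 := by
  rw [pathSeries, PowerSeries.coeff_mul, Finset.Nat.sum_antidiagonal_eq_sum_range_succ_mk]
  simp only [coeff_coe, coeff_monomial, PowerSeries.coeff_mk, ite_mul, zero_mul,
    Finset.sum_ite_eq, Finset.mem_range, Nat.succ_lt_succ_iff]

theorem pathSeries_mulVec {k : Type*} [Fintype k] [DecidableEq k] (Q : Matrix k k R[X])
    (y : k → R[X]) (a : k) (i₀ j : n) :
    pathSeries C i₀ ((1 - Q).mulVec y a) j =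
      pathSeries C i₀ (y a) j - ∑ b, (Q a b : PowerSeries R) * pathSeries C i₀ (y b) j := by
  have hcoe : (((1 - Q).mulVec y a : R[X]) : PowerSeries R) =
      y a - ∑ b, (Q a b : PowerSeries R) * (y b : PowerSeries R) := by
    ext t
    simp only [Matrix.sub_mulVec, Matrix.one_mulVec, Pi.sub_apply, ← coe_mul, coeff_coe, coeff_sub,
      map_sub, map_sum]
    rw [Matrix.mulVec, dotProduct, finsetSum_coeff]
  simp only [pathSeries, hcoe, sub_mul, Finset.sum_mul, mul_assoc]

end PathSeries

section Estimate

variable {G : Type*} [Group G] {β γ : ℝ}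

theorem abs_coeff_mul_le {x y : ZG G} {c : ℝ} (hx : ∀ g, |(x.coeff g : ℝ)| ≤ c)
    (hy : y ∈ nonnegCone G) (g : G) : |((x * y).coeff g : ℝ)| ≤ c * aug y := by
  rw [MonoidAlgebra.coeff_mul_apply_right, aug_apply, Finsupp.sum, Finsupp.sum]
  push_cast
  rw [Finset.mul_sum]
  refine (Finset.abs_sum_le_sum_abs _ _).trans (Finset.sum_le_sum fun h _ => ?_)
  have hyh : (0 : ℝ) ≤ y.coeff h := Int.cast_nonneg (hy h)
  rw [abs_mul, abs_of_nonneg hyh]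
  exact mul_le_mul_of_nonneg_right (hx _) hyh

theorem abs_coeff_coe_mul_le (hβ : 0 < β) (hβγ : β < γ) {p : (ZG G)[X]}
    (hp : ∀ m g, |((p.coeff m).coeff g : ℝ)| ≤ β ^ m) {r : ℕ} (hpr : ∀ m < r, p.coeff m = 0)
    {V W : PowerSeries (ZG G)} (hV : ∀ t, PowerSeries.coeff t V ∈ nonnegCone G)
    (hW : ∀ t, PowerSeries.coeff t W ∈ nonnegCone G) {K : ℝ} (hK : 0 ≤ K)
    (hWV : ∀ m, r ≤ m → ∀ u h, γ ^ m * aug (PowerSeries.coeff u W) ≤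
      K * ((PowerSeries.coeff (m + u) V).coeff h : ℝ)) (t : ℕ) (h : G) :
    |((PowerSeries.coeff t ((p : PowerSeries (ZG G)) * W)).coeff h : ℝ)| ≤
      K * ((β / γ) ^ r / (1 - β / γ)) * (PowerSeries.coeff t V).coeff h := by
  have hγ : 0 < γ := hβ.trans hβγ
  have hVt : (0 : ℝ) ≤ (PowerSeries.coeff t V).coeff h := Int.cast_nonneg (hV t h)
  have hterm : ∀ m ∈ Finset.Ico r (t + 1),
      |((p.coeff m * PowerSeries.coeff (t - m) W).coeff h : ℝ)| ≤
        (β / γ) ^ m * (K * (PowerSeries.coeff t V).coeff h) := by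
    intro m hm
    rw [Finset.mem_Ico] at hm
    calc _ ≤ β ^ m * aug (PowerSeries.coeff (t - m) W) := abs_coeff_mul_le (hp m) (hW _) h
      _ = (β / γ) ^ m * (γ ^ m * aug (PowerSeries.coeff (t - m) W)) := by
          rw [← mul_assoc, ← mul_pow, div_mul_cancel₀ _ hγ.ne']
      _ ≤ (β / γ) ^ m * (K * (PowerSeries.coeff t V).coeff h) := by
          refine mul_le_mul_of_nonneg_left ?_ (by positivity)
          have := hWV m hm.1 (t - m) h
          rwa [Nat.add_sub_cancel' (Nat.lt_succ_iff.1 hm.2)] at this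
  have hsupp : PowerSeries.coeff t ((p : PowerSeries (ZG G)) * W) =
      ∑ m ∈ Finset.Ico r (t + 1), p.coeff m * PowerSeries.coeff (t - m) W := by
    rw [PowerSeries.coeff_mul, Finset.Nat.sum_antidiagonal_eq_sum_range_succ_mk]
    simp only [coeff_coe]
    refine (Finset.sum_subset (fun m hm => ?_) fun m _ hm => ?_).symm
    · exact Finset.mem_range.2 (Finset.mem_Ico.1 hm).2
    · rw [hpr m (by simp_all), zero_mul]
  rw [hsupp, coeff_sum_apply, Int.cast_sum]
  calc _ ≤ ∑ m ∈ Finset.Ico r (t + 1), (β / γ) ^ m * (K * (PowerSeries.coeff t V).coeff h) :=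
        (Finset.abs_sum_le_sum_abs _ _).trans (Finset.sum_le_sum hterm)
    _ ≤ (β / γ) ^ r / (1 - β / γ) * (K * (PowerSeries.coeff t V).coeff h) := by
        rw [← Finset.sum_mul]
        exact mul_le_mul_of_nonneg_right (geom_sum_Ico_le_of_lt_one (by positivity)
          ((div_lt_one hγ).2 hβγ)) (mul_nonneg hK hVt)
    _ = _ := by ring

variable {n : Type*} [Fintype n] [DecidableEq n] {C : Matrix n n (ZG G)[X]} {i₀ : n} {m₀ : ℕ}

theorem coeff_pathSeries_single_mem (hC : EntriesIn (polyOver (nonnegCone G)) C) (c : ℕ) (x : G)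
    (j : n) (t : ℕ) : PowerSeries.coeff t
      (pathSeries C i₀ (monomial (c + 1) (MonoidAlgebra.single x 1)) j) ∈ nonnegCone G := by
  rw [coeff_pathSeries_monomial]
  split_ifs
  exacts [mul_mem (single_mem_nonnegCone x zero_le_one) (pathSum_mem hC i₀ _ j), zero_mem _]

theorem pow_mul_aug_coeff_pathSeries_le (hC : EntriesIn (polyOver (nonnegCone G)) C) (hγ : 1 ≤ γ)
    (hz : ∀ m, m₀ ≤ m → ∀ g, γ ^ m ≤ ((pathSum C i₀ m i₀).coeff g : ℝ)) {M d : ℕ} (hd : d ≤ M)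
    (c : ℕ) (x y : G) (j : n) {m : ℕ} (hm : M + m₀ < m) (u : ℕ) (h : G) :
    γ ^ m * aug (PowerSeries.coeff u
        (pathSeries C i₀ (monomial (c + 1) (MonoidAlgebra.single x 1)) j)) ≤
      γ ^ M * ((PowerSeries.coeff (m + u)
        (pathSeries C i₀ (monomial (d + 1) (MonoidAlgebra.single y 1)) j)).coeff h : ℝ) := by
  have : 0 < γ := one_pos.trans_le hγ
  rw [coeff_pathSeries_monomial, coeff_pathSeries_monomial, if_pos (show d < m + u by omega),
    MonoidAlgebra.coeff_single_mul_apply, one_mul]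
  split_ifs with hcu
  · have haug : aug (MonoidAlgebra.single x 1 : ZG G) = 1 := by simp [aug_apply]
    have hlen : m + u - (d + 1) = (m + c - d) + (u - (c + 1)) := by omega
    rw [map_mul, haug, one_mul, hlen]
    calc γ ^ m * aug (pathSum C i₀ (u - (c + 1)) j)
        ≤ γ ^ M * γ ^ (m + c - d) * aug (pathSum C i₀ (u - (c + 1)) j) := by
          rw [← pow_add]
          exact mul_le_mul_of_nonneg_right (pow_le_pow_right₀ hγ (by omega))
            (Int.cast_nonneg (aug_nonneg (pathSum_mem hC i₀ _ j)))
      _ ≤ _ := by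
          rw [mul_assoc]
          exact mul_le_mul_of_nonneg_left (pow_mul_aug_le_coeff_pathSum hC (hz _ (by omega)) _ j _)
            (by positivity)
  · rw [map_zero, Int.cast_zero, mul_zero]
    exact mul_nonneg (by positivity) (Int.cast_nonneg (pathSum_mem hC i₀ _ j _))

variable {k : Type*} [Fintype k] [DecidableEq k]

/- The paths whose first edge is changed by `Q` lose a length of at least `r` during which their
number would have grown by the factor `γ ^ r`, whereas the coefficients of `Q` only account for
`β ^ r`. -/
theorem half_le_coeff_pathSeries (hC : EntriesIn (polyOver (nonnegCone G)) C) (hβ : 0 < β)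
    (hγ : 1 ≤ γ) (hβγ : β < γ)
    (hz : ∀ m, m₀ ≤ m → ∀ g, γ ^ m ≤ ((pathSum C i₀ m i₀).coeff g : ℝ)) {M r : ℕ}
    (hr : M + m₀ < r)
    (hsmall : Fintype.card k * (γ ^ M * ((β / γ) ^ r / (1 - β / γ))) ≤ 1 / 2)
    {s : k → ℕ} (hs : ∀ a, s a ≤ M) (g : k → G) {Q : Matrix k k (ZG G)[X]}
    (hQ : ∀ i j m g, |(((Q i j).coeff m).coeff g : ℝ)| ≤ β ^ m)
    (hQr : ∀ i j, ∀ m < r, (Q i j).coeff m = 0) (a : k) (j : n) (t : ℕ) (h : G) :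
    1 / 2 * ((PowerSeries.coeff t (pathSeries C i₀
        (monomial (s a + 1) (MonoidAlgebra.single (g a) 1)) j)).coeff h : ℝ) ≤
      (PowerSeries.coeff t (pathSeries C i₀ ((1 - Q).mulVec
        (fun b => monomial (s b + 1) (MonoidAlgebra.single (g b) 1)) a) j)).coeff h := by
  let W := fun b => pathSeries C i₀ (monomial (s b + 1) (MonoidAlgebra.single (g b) 1)) j
  have hW : ∀ b t, PowerSeries.coeff t (W b) ∈ nonnegCone G := fun b =>
    coeff_pathSeries_single_mem hC (s b) (g b) j
  have herr : ∀ b, |((PowerSeries.coeff t ((Q a b : PowerSeries (ZG G)) * W b)).coeff h : ℝ)| ≤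
      γ ^ M * ((β / γ) ^ r / (1 - β / γ)) * (PowerSeries.coeff t (W a)).coeff h := fun b =>
    abs_coeff_coe_mul_le hβ hβγ (hQ a b) (hQr a b) (hW a) (hW b)
      (pow_nonneg (zero_le_one.trans hγ) M) (fun m hm => pow_mul_aug_coeff_pathSeries_le hC hγ hz
        (hs a) (s b) (g b) (g a) j (hr.trans_le hm)) t h
  have hsum : ∑ b, ((PowerSeries.coeff t ((Q a b : PowerSeries (ZG G)) * W b)).coeff h : ℝ) ≤
      1 / 2 * (PowerSeries.coeff t (W a)).coeff h :=
    calc _ ≤ ∑ _b : k, γ ^ M * ((β / γ) ^ r / (1 - β / γ)) * (PowerSeries.coeff t (W a)).coeff h :=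
          Finset.sum_le_sum fun b _ => (le_abs_self _).trans (herr b)
      _ = Fintype.card k * (γ ^ M * ((β / γ) ^ r / (1 - β / γ))) *
            (PowerSeries.coeff t (W a)).coeff h := by
          rw [Finset.sum_const, Finset.card_univ, nsmul_eq_mul, ← mul_assoc]
      _ ≤ _ := mul_le_mul_of_nonneg_right hsmall (Int.cast_nonneg (hW a t h))
  rw [pathSeries_mulVec, map_sub, map_sum, MonoidAlgebra.coeff_sub, Finsupp.sub_apply,
    coeff_sum_apply]
  push_cast
  linarith

end Estimate

section Truncation

variable {R : Type*} [Ring R] {k n : Type*} [Fintype n] [DecidableEq n]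

/-- The edges `startEdges i₀ y` followed by paths, up to the length `N`, or up to `N - q` for those
that end at `i₀`. The different bounds match the lengths of the edges of a row expansion, which
leave `i₀` with length `q + 1`: one further edge always leads to length at most `N + 1`. -/
def truncPaths (C : Matrix n n R[X]) (i₀ : n) (q N : ℕ) (y : k → R[X]) : Matrix k n R[X] :=
  Matrix.of fun a j =>
    PowerSeries.trunc ((if j = i₀ then N - q else N) + 1) (pathSeries C i₀ (y a) j)

variable {C : Matrix n n R[X]} {i₀ : n} {q N : ℕ} {y : k → R[X]}

theorem coeff_truncPaths (C : Matrix n n R[X]) (i₀ : n) (q N : ℕ) (y : k → R[X]) (a : k) (j : n)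
    (e : ℕ) : (truncPaths C i₀ q N y a j).coeff e =
      if e ≤ (if j = i₀ then N - q else N) then PowerSeries.coeff e (pathSeries C i₀ (y a) j)
      else 0 := by
  simp only [truncPaths, Matrix.of_apply, PowerSeries.coeff_trunc, Nat.lt_succ_iff]

theorem coeff_zero_pathSeries {z : R[X]} (hz : z.coeff 0 = 0) (j : n) :
    PowerSeries.coeff 0 (pathSeries C i₀ z j) = 0 := by
  simp [pathSeries, PowerSeries.coeff_mul, hz]

theorem EntriesIn.truncPaths {P : Subsemiring R} (hy0 : ∀ a, (y a).coeff 0 = 0)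
    (hy : ∀ a t j, PowerSeries.coeff t (pathSeries C i₀ (y a) j) ∈ P) :
    EntriesIn (tPolyOver P) (truncPaths C i₀ q N y) := fun a j => by
  refine ⟨?_, fun e => ?_⟩ <;> rw [coeff_truncPaths]
  · rw [coeff_zero_pathSeries (hy0 a), ite_self]
  split_ifs
  exacts [hy a e j, zero_mem P, hy a e j, zero_mem P]

variable {A : Matrix n n R}

theorem coeff_startEdges_add_truncPaths_mul (hC : IsRowExpansion A i₀ q C) (a : k) {j : n} {e : ℕ}
    (he : e ≤ N + 1) (hej : j = i₀ → e ≤ N - q + 1) :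
    ((startEdges i₀ y + truncPaths C i₀ q N y * C) a j).coeff e =
      PowerSeries.coeff e (pathSeries C i₀ (y a) j) := by
  have hstart : PowerSeries.coeff e (if j = i₀ then (y a : PowerSeries R) else 0) =
      (startEdges i₀ y a j).coeff e := by
    rw [coeff_startEdges]
    split_ifs <;> simp
  rw [pathSeries_eq hC.coeff_zero, map_add, map_sum, hstart, Matrix.add_apply, coeff_add,
    Matrix.mul_apply, finsetSum_coeff]
  congr 1
  refine Finset.sum_congr rfl fun l _ => ?_
  rw [PowerSeries.coeff_mul, coeff_mul]
  refine Finset.sum_congr rfl fun ⟨u, v⟩ huv => ?_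
  have huv : u + v = e := Finset.HasAntidiagonal.mem_antidiagonal.1 huv
  rw [coeff_coe, coeff_truncPaths]
  dsimp only
  split_ifs with hl hu hu
  · rfl
  · have hv : (C l j).coeff v = 0 := by
      rcases Nat.eq_zero_or_pos v with rfl | hv0
      · exact hC.coeff_zero l j
      · have hj : j ≠ i₀ := fun hj => by have := hej hj; omega
        rw [hl, hC.apply_exit hj, coeff_monomial_of_ne _ (by omega)]
    rw [hv, mul_zero, mul_zero]
  · rfl
  · rw [show v = 0 by omega, hC.coeff_zero, mul_zero, mul_zero]

theorem coeff_truncPaths_mul_of_lt (hC : IsRowExpansion A i₀ q C) (hqN : q ≤ N) (a : k) (j : n)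
    {e : ℕ} (he : N + 1 < e) : ((truncPaths C i₀ q N y * C) a j).coeff e = 0 := by
  rw [Matrix.mul_apply, finsetSum_coeff]
  refine Finset.sum_eq_zero fun l _ => ?_
  rw [coeff_mul]
  refine Finset.sum_eq_zero fun ⟨u, v⟩ huv => ?_
  have huv : u + v = e := Finset.HasAntidiagonal.mem_antidiagonal.1 huv
  rw [coeff_truncPaths]
  dsimp only
  split_ifs with hl hu hu
  · rw [hC.coeff_eq_zero l j (by omega), mul_zero]
  · rw [zero_mul]
  · rw [hC.apply_of_ne j hl, coeff_monomial_of_ne _ (by omega), mul_zero]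
  · rw [zero_mul]

theorem coeff_startEdges_add_truncPaths_mul_of_lt (hy : ∀ a e, N - q < e → (y a).coeff e = 0)
    (a : k) (j : n) {e : ℕ} (he : N - q < e) :
    ((startEdges i₀ y + truncPaths C i₀ q N y * C) a j).coeff e =
      ((truncPaths C i₀ q N y * C) a j).coeff e := by
  rw [Matrix.add_apply, coeff_add, coeff_startEdges, hy a e he, ite_self, zero_add]

theorem coeff_startEdges_sub_truncPaths_mul (hC : IsRowExpansion A i₀ q C)
    (hy : ∀ a e, N - q < e → (y a).coeff e = 0) (a : k) (j : n) (e : ℕ) :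
    ((startEdges i₀ y - truncPaths C i₀ q N y * (1 - C) : Matrix k n R[X]) a j).coeff e =
      if e ≤ (if j = i₀ then N - q else N) then 0
      else ((truncPaths C i₀ q N y * C) a j).coeff e := by
  rw [Matrix.mul_sub, Matrix.mul_one, ← sub_add, sub_add_eq_add_sub, Matrix.sub_apply, coeff_sub,
    coeff_truncPaths]
  split_ifs with hj he he
  · rw [coeff_startEdges_add_truncPaths_mul hC a (by omega) fun _ => by omega, sub_self]
  · rw [coeff_startEdges_add_truncPaths_mul_of_lt hy a j (not_le.1 he), sub_zero]
  · rw [coeff_startEdges_add_truncPaths_mul hC a (by omega) (absurd · hj), sub_self]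
  · rw [coeff_startEdges_add_truncPaths_mul_of_lt hy a j (by omega), sub_zero]

variable {P : Subsemiring R}

theorem EntriesIn.startEdges_add_truncPaths_mul (hC : IsRowExpansion A i₀ q C)
    (hCP : EntriesIn (polyOver P) C) (hy0 : ∀ a, (y a).coeff 0 = 0)
    (hyN : ∀ a e, N - q < e → (y a).coeff e = 0)
    (hy : ∀ a t j, PowerSeries.coeff t (pathSeries C i₀ (y a) j) ∈ P) :
    EntriesIn (tPolyOver P) (startEdges i₀ y + GExt.truncPaths C i₀ q N y * C) := fun a j => by
  have hF : ∀ e ≤ N - q, ((startEdges i₀ y + GExt.truncPaths C i₀ q N y * C) a j).coeff e =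
      PowerSeries.coeff e (pathSeries C i₀ (y a) j) := fun e he =>
    coeff_startEdges_add_truncPaths_mul hC a (by omega) fun _ => by omega
  refine ⟨by rw [hF 0 (Nat.zero_le _), coeff_zero_pathSeries (hy0 a)], fun e => ?_⟩
  rcases le_or_gt e (N - q) with he | he
  · exact hF e he ▸ hy a e j
  · rw [coeff_startEdges_add_truncPaths_mul_of_lt hyN a j he]
    exact (EntriesIn.truncPaths hy0 hy).of_tPolyOver.mul hCP a j e

theorem EntriesIn.startEdges_sub_truncPaths_mul (hC : IsRowExpansion A i₀ q C)
    (hCP : EntriesIn (polyOver P) C) (hy0 : ∀ a, (y a).coeff 0 = 0)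
    (hyN : ∀ a e, N - q < e → (y a).coeff e = 0)
    (hy : ∀ a t j, PowerSeries.coeff t (pathSeries C i₀ (y a) j) ∈ P) :
    EntriesIn (tPolyOver P) (startEdges i₀ y - GExt.truncPaths C i₀ q N y * (1 - C)) :=
    fun a j => by
  refine ⟨?_, fun e => ?_⟩ <;> rw [coeff_startEdges_sub_truncPaths_mul hC hyN]
  · rw [if_pos (Nat.zero_le _)]
  · have hρC := (EntriesIn.truncPaths (q := q) (N := N) hy0 hy).of_tPolyOver.mul hCP a j e
    split_ifs
    exacts [zero_mem P, hρC, zero_mem P, hρC]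

end Truncation

section PathExtension

variable {R : Type*} [Ring R] {k n : Type*} [Fintype n] [DecidableEq n]

/-- The matrix `B` of the theorem. Its paths from the new vertices `k` start with the edges
`startEdges i₀ y`; cutting them at length `N` keeps the degree finite. -/
def pathExtension (Q : Matrix k k R[X]) (C : Matrix n n R[X]) (i₀ : n) (q N : ℕ) (y : k → R[X]) :
    Matrix (k ⊕ n) (k ⊕ n) R[X] :=
  Matrix.fromBlocks Q 0 0 0 + pathBlocks (startEdges i₀ y) (truncPaths C i₀ q N y)
    ((rowOnes k i₀ : Matrix n k R).map Polynomial.C) C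

variable {Q : Matrix k k R[X]} {A : Matrix n n R} {C : Matrix n n R[X]} {i₀ : n} {q N : ℕ}
  {y : k → R[X]}

theorem pathExtension_inl_inl (a b : k) : pathExtension Q C i₀ q N y (.inl a) (.inl b) =
    Q a b + (startEdges i₀ y + truncPaths C i₀ q N y * C) a i₀ :=
  congrArg (Q a b + ·) (mul_rowOnes_apply (startEdges i₀ y + truncPaths C i₀ q N y * C) i₀ a b)

theorem pathExtension_inl_inr (a : k) (j : n) : pathExtension Q C i₀ q N y (.inl a) (.inr j) =
    (startEdges i₀ y - truncPaths C i₀ q N y * (1 - C) : Matrix k n R[X]) a j :=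
  zero_add _

theorem pathExtension_inr_inl (i : n) (b : k) :
    pathExtension Q C i₀ q N y (.inr i) (.inl b) = C i i₀ :=
  (zero_add _).trans (mul_rowOnes_apply C i₀ i b)

theorem pathExtension_inr_inr (i j : n) :
    pathExtension Q C i₀ q N y (.inr i) (.inr j) = C i j :=
  zero_add _

theorem coeff_pathExtension_inl_inl (hC : IsRowExpansion A i₀ q C) (a b : k) {e : ℕ}
    (he : e ≤ N - q + 1) : (pathExtension Q C i₀ q N y (.inl a) (.inl b)).coeff e =
      (Q a b).coeff e + PowerSeries.coeff e (pathSeries C i₀ (y a) i₀) := by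
  rw [pathExtension_inl_inl, coeff_add,
    coeff_startEdges_add_truncPaths_mul hC a (by omega) fun _ => he]

theorem coeff_pathExtension_inl_of_lt (hC : IsRowExpansion A i₀ q C)
    (hyN : ∀ a e, N - q < e → (y a).coeff e = 0)
    (hQN : ∀ a b e, N - q < e → (Q a b).coeff e = 0) (a : k) (j : k ⊕ n) {e : ℕ} (he : N < e) :
    (pathExtension Q C i₀ q N y (.inl a) j).coeff e =
      ((truncPaths C i₀ q N y * C) a (j.elim (fun _ => i₀) id)).coeff e := by
  rcases j with b | j
  · rw [pathExtension_inl_inl, coeff_add, hQN a b e (by omega), zero_add,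
      coeff_startEdges_add_truncPaths_mul_of_lt hyN a i₀ (by omega), Sum.elim_inl]
  · rw [pathExtension_inl_inr, coeff_startEdges_sub_truncPaths_mul hC hyN,
      if_neg (by split_ifs <;> omega), Sum.elim_inr, id]

theorem coeff_pathExtension_of_lt (hC : IsRowExpansion A i₀ q C) (hqN : q ≤ N)
    (hyN : ∀ a e, N - q < e → (y a).coeff e = 0)
    (hQN : ∀ a b e, N - q < e → (Q a b).coeff e = 0) (i j : k ⊕ n) {e : ℕ} (he : N + 1 < e) :
    (pathExtension Q C i₀ q N y i j).coeff e = 0 := by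
  rcases i with a | i
  · rw [coeff_pathExtension_inl_of_lt hC hyN hQN a j (by omega),
      coeff_truncPaths_mul_of_lt hC hqN a _ he]
  · rcases j with b | j
    · rw [pathExtension_inr_inl, hC.coeff_eq_zero i i₀ (by omega)]
    · rw [pathExtension_inr_inr, hC.coeff_eq_zero i j (by omega)]

theorem EntriesIn.pathExtension {P : Subsemiring R} (hC : IsRowExpansion A i₀ q C)
    (hCP : EntriesIn (tPolyOver P) C) (hy0 : ∀ a, (y a).coeff 0 = 0)
    (hyN : ∀ a e, N - q < e → (y a).coeff e = 0)
    (hy : ∀ a t j, PowerSeries.coeff t (pathSeries C i₀ (y a) j) ∈ P)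
    (hQ0 : ∀ a b, (Q a b).coeff 0 = 0) (hQN : ∀ a b e, N - q < e → (Q a b).coeff e = 0)
    (hQ : ∀ a b e, (Q a b).coeff e + PowerSeries.coeff e (pathSeries C i₀ (y a) i₀) ∈ P) :
    EntriesIn (tPolyOver P) (pathExtension Q C i₀ q N y) := by
  have hF := EntriesIn.startEdges_add_truncPaths_mul hC hCP.of_tPolyOver hy0 hyN hy
  rintro (a | i) (b | j)
  · refine ⟨?_, fun e => ?_⟩
    · rw [pathExtension_inl_inl, coeff_add, hQ0, (hF a i₀).1, add_zero]
    · rcases le_or_gt e (N - q) with he | he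
      · rw [coeff_pathExtension_inl_inl hC a b (by omega)]
        exact hQ a b e
      · rw [pathExtension_inl_inl, coeff_add, hQN a b e he, zero_add]
        exact (hF a i₀).2 e
  · rw [pathExtension_inl_inr]
    exact EntriesIn.startEdges_sub_truncPaths_mul hC hCP.of_tPolyOver hy0 hyN hy a j
  · rw [pathExtension_inr_inl]
    exact hCP i i₀
  · rw [pathExtension_inr_inr]
    exact hCP i j

theorem expandRow_eq_add_deleteLoops [Fintype k] (A : Matrix n n R) (i₀ : n) (q : ℕ) (s : k → ℕ)
    (x : k → R) : expandRow A i₀ q = (rowOnes k i₀ : Matrix n k R).map Polynomial.C *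
      startEdges i₀ (fun a => monomial (s a + 1) (x a)) + deleteLoops A i₀ q s x := by
  rw [deleteLoops, add_sub_cancel]

theorem ElEquiv.pathExtension [Fintype k] [DecidableEq k] {P : Matrix k k R[X]}
    (hP : P * (1 - Q) = 1) (s : k → ℕ) (x : k → R) :
    ElEquiv (Matrix.fromBlocks (1 - Q) 0 0 (1 - tMul A))
      (1 - pathExtension Q (deleteLoops A i₀ q s x) i₀ q N
        ((1 - Q).mulVec fun a => monomial (s a + 1) (x a))) := by
  obtain ⟨E, hE, hEA⟩ := exists_El_expandRow A i₀ q
  rw [expandRow_eq_add_deleteLoops A i₀ q s x] at hEA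
  have h := ElEquiv.fromBlocks_of_mul_left (ρ := truncPaths (deleteLoops A i₀ q s x) i₀ q N
    ((1 - Q).mulVec fun a => monomial (s a + 1) (x a))) hE hEA hP
  rw [mul_startEdges] at h
  rwa [GExt.pathExtension, pathBlocks, Matrix.fromBlocks_add, zero_add, zero_add, zero_add]

end PathExtension

section Map

variable {R R' : Type*} [Ring R] [Ring R'] (f : R →+* R')

theorem map_polyCompanion {m : Type*} [DecidableEq m] (L : ℕ) (B : Matrix m m R[X]) :
    (polyCompanion L B).map f = polyCompanion L (B.map (mapRingHom f)) := by
  ext x y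
  by_cases h : x.2 = y.2 <;>
    simp [polyCompanion, blockCompanion, coeffMatrix_apply, Matrix.one_apply, apply_ite f, h]

variable {f} {P : Subsemiring R} {P' : Subsemiring R'}

theorem EntriesIn.map {m n : Type*} (hf : P ≤ P'.comap f) {M : Matrix m n R} (hM : EntriesIn P M) :
    EntriesIn P' (M.map f) := fun i j => hf (hM i j)

theorem EntriesIn.map_mapRingHom {m n : Type*} (hf : P ≤ P'.comap f) {M : Matrix m n R[X]}
    (hM : EntriesIn (tPolyOver P) M) : EntriesIn (tPolyOver P') (M.map (mapRingHom f)) :=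
  fun i j => ⟨by simp [(hM i j).1], fun e => by simpa using hf ((hM i j).2 e)⟩

theorem sse_map_box {m : Type} [Fintype m] [DecidableEq m] {B : Matrix m m R[X]}
    (hB : EntriesIn (polyOver P') (B.map (mapRingHom f))) :
    SSE (P' : Set R') ((box B).map f) (box (B.map (mapRingHom f))) := by
  rw [box_eq_polyCompanion, map_polyCompanion]
  have hdeg := (polyDegree_le_iff (B := B)).1 le_rfl
  refine sse_polyCompanion_box hB (polyDegree_le_iff.2 ⟨hdeg.1, fun i j e he => ?_⟩)
  rw [Matrix.map_apply, coe_mapRingHom, coeff_map, hdeg.2 i j e he, map_zero]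

theorem map_startEdges {k n : Type*} [DecidableEq n] (i₀ : n) (y : k → R[X]) :
    (startEdges i₀ y).map (mapRingHom f) = startEdges i₀ (mapRingHom f ∘ y) := by
  ext1 a j
  by_cases hj : j = i₀ <;> simp [startEdges, hj]

theorem map_rowOnes (k : Type*) {n : Type*} [DecidableEq n] (i₀ : n) :
    ((rowOnes k i₀ : Matrix n k R).map Polynomial.C).map (mapRingHom f) =
      (rowOnes k i₀ : Matrix n k R').map Polynomial.C := by
  ext1 i a
  by_cases hi : i = i₀ <;> simp [rowOnes, hi]

theorem map_pathExtension {k n : Type*} [Fintype k] [DecidableEq k] [Fintype n] [DecidableEq n]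
    {Q : Matrix k k R[X]} (hQ : Q.map (mapRingHom f) = 0) (C : Matrix n n R[X]) (i₀ : n) (q N : ℕ)
    (z : k → R[X]) : (pathExtension Q C i₀ q N ((1 - Q).mulVec z)).map (mapRingHom f) =
      pathBlocks (startEdges i₀ (mapRingHom f ∘ z))
        ((truncPaths C i₀ q N ((1 - Q).mulVec z)).map (mapRingHom f))
        ((rowOnes k i₀ : Matrix n k R').map Polynomial.C) (C.map (mapRingHom f)) := by
  have hstart : (startEdges i₀ ((1 - Q).mulVec z)).map (mapRingHom f) =
      startEdges i₀ (mapRingHom f ∘ z) := by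
    rw [← mul_startEdges, Matrix.map_mul, Matrix.map_sub _ (map_sub _), hQ,
      Matrix.map_one _ (map_zero _) (map_one _), sub_zero, Matrix.one_mul, map_startEdges]
  rw [pathExtension, Matrix.map_add _ (map_add _), Matrix.fromBlocks_map, hQ,
    Matrix.map_zero _ (map_zero _), Matrix.map_zero _ (map_zero _), Matrix.map_zero _ (map_zero _),
    Matrix.fromBlocks_zero, zero_add, pathBlocks, pathBlocks, Matrix.fromBlocks_map]
  simp only [Matrix.map_mul, Matrix.map_add _ (map_add (mapRingHom f)),
    Matrix.map_sub _ (map_sub (mapRingHom f)), Matrix.map_one _ (map_zero _) (map_one _), hstart,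
    map_rowOnes]

variable {k n : Type} [Fintype k] [DecidableEq k] [Fintype n] [DecidableEq n]

theorem sse_map_box_pathExtension (hf : P ≤ P'.comap f) {Q : Matrix k k R[X]} {A : Matrix n n R}
    {i₀ : n} {q N : ℕ} {s : k → ℕ} {x : k → R} {y : k → R[X]}
    (hy : y = (1 - Q).mulVec fun a => monomial (s a + 1) (x a))
    (hQ : Q.map (mapRingHom f) = 0) (hA : EntriesIn P A) (hx : ∀ a, x a ∈ P)
    (hC : EntriesIn (tPolyOver P) (deleteLoops A i₀ q s x))
    (hρ : EntriesIn (tPolyOver P) (truncPaths (deleteLoops A i₀ q s x) i₀ q N y))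
    (hB : EntriesIn (tPolyOver P) (pathExtension Q (deleteLoops A i₀ q s x) i₀ q N y)) :
    SSE (P' : Set R') ((box (pathExtension Q (deleteLoops A i₀ q s x) i₀ q N y)).map f)
      (A.map f) := by
  subst hy
  have hB' := (hB.map_mapRingHom hf).of_tPolyOver
  have hsse := sse_map_box hB'
  rw [map_pathExtension hQ] at hB' hsse
  refine hsse.trans (sse_pathBlocks (i₀ := i₀) (q := q) (hA.map hf) ?_ (hρ.map_mapRingHom hf) ?_
    (hC.map_mapRingHom hf) (fun a j => hB' (.inl a) (.inr j)) ?_).symm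
  · intro a j
    by_cases hj : j = i₀
    · have hfx : f (x a) ∈ P' := hf (hx a)
      simpa [startEdges, hj] using monomial_mem_tPolyOver (Nat.succ_ne_zero (s a)) hfx
    · simp [startEdges, hj]
  · intro i a
    by_cases hi : i = i₀ <;> simp [rowOnes, hi]
  · rw [← map_expandRow, expandRow_eq_add_deleteLoops A i₀ q s x, Matrix.map_add _ (map_add _),
      Matrix.map_mul, map_rowOnes, map_startEdges]

end Map

section PrimitiveExtension

variable {G : Type*} [Group G] {k n : Type*} [Fintype n] [DecidableEq n]
  {A : Matrix n n (ZG G)} {C : Matrix n n (ZG G)[X]} {i₀ : n} {q N : ℕ} {y : k → (ZG G)[X]}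

theorem coeff_truncPaths_mul_ne_zero (hC : IsRowExpansion A i₀ q C)
    (hCP : EntriesIn (polyOver (nonnegCone G)) C) (hy0 : ∀ a, (y a).coeff 0 = 0)
    (hy : ∀ a t j, PowerSeries.coeff t (pathSeries C i₀ (y a) j) ∈ nonnegCone G) {a : k} {l j : n}
    (hl : l ≠ i₀) (hlj : A l j ≠ 0) (hN : PowerSeries.coeff N (pathSeries C i₀ (y a) l) ≠ 0) :
    ((truncPaths C i₀ q N y * C) a j).coeff (N + 1) ≠ 0 := by
  have hρ := (EntriesIn.truncPaths (q := q) (N := N) hy0 hy).of_tPolyOver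
  have hmem : ∀ (l : n) (u v : ℕ),
      (truncPaths C i₀ q N y a l).coeff u * (C l j).coeff v ∈ nonnegCone G :=
    fun l u v => mul_mem (hρ a l u) (hCP l j v)
  rw [Matrix.mul_apply, finsetSum_coeff]
  simp only [coeff_mul]
  refine sum_ne_zero_of_mem (fun l _ => sum_mem fun u _ => hmem l _ _) (Finset.mem_univ l)
    (sum_ne_zero_of_mem (fun u _ => hmem l _ _)
      (i := (N, 1)) (Finset.HasAntidiagonal.mem_antidiagonal.2 rfl)
      (mul_ne_zero_of_mem (hρ a l _) (hCP l j _) ?_ ?_))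
  · rwa [coeff_truncPaths, if_neg hl, if_pos le_rfl]
  · rwa [hC.apply_of_ne j hl, coeff_monomial_same]

theorem IsRowExpansion.loop_ne_zero (hC : IsRowExpansion A i₀ q C) {m : ℕ} (hm : m ≠ 0)
    (hmq : m ≤ q) (hne : pathSum C i₀ m i₀ ≠ 0) : C i₀ i₀ ≠ 0 := by
  intro h0
  obtain ⟨m, rfl⟩ := Nat.exists_eq_succ_of_ne_zero hm
  refine hne ?_
  rw [pathSum_succ]
  refine Finset.sum_eq_zero fun e he => Finset.sum_eq_zero fun l _ => ?_
  have hem := Finset.mem_range.1 he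
  by_cases hl : l = i₀
  · rw [hl, h0, Polynomial.coeff_zero, mul_zero]
  · rw [hC.pathSum_eq_zero (by omega) hl, zero_mul]

theorem reflTransGen_of_pow_apply_ne_zero {R : Type*} [Semiring R] {A : Matrix n n R} {p : ℕ}
    {i j : n} (h : (A ^ p) i j ≠ 0) : Relation.ReflTransGen (fun i j => A i j ≠ 0) i j := by
  induction p generalizing i with
  | zero =>
    rw [pow_zero] at h
    exact not_imp_comm.1 (Matrix.one_apply_ne) h ▸ .refl
  | succ p ih =>
    rw [pow_succ', Matrix.mul_apply] at h
    obtain ⟨l, -, hl⟩ := Finset.exists_ne_zero_of_sum_ne_zero h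
    exact .head (left_ne_zero_of_mul hl) (ih (right_ne_zero_of_mul hl))

theorem reflTransGen_pathExtension {Q : Matrix k k (ZG G)[X]} (hA : GPrimitive A)
    (hC : IsRowExpansion A i₀ q C) (hloop : C i₀ i₀ ≠ 0) {a : k}
    (ha : ∀ b, pathExtension Q C i₀ q N y (.inl b) (.inl a) ≠ 0) (j : k ⊕ n) :
    Relation.ReflTransGen (fun i j => pathExtension Q C i₀ q N y i j ≠ 0) j (.inl a) := by
  have hedge : ∀ i j, i ≠ i₀ → A i j ≠ 0 → C i j ≠ 0 := fun i j hi h => by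
    rwa [hC.apply_of_ne j hi, Ne, monomial_eq_zero_iff]
  have hi₀ : Relation.ReflTransGen (fun i j => pathExtension Q C i₀ q N y i j ≠ 0)
      (.inr i₀) (.inl a) := .single (by rwa [pathExtension_inr_inl])
  rcases j with b | j
  · exact .single (ha b)
  · obtain ⟨p, -, hp⟩ := hA.2
    have hpath := reflTransGen_of_pow_apply_ne_zero (hp j i₀).ne_zero
    induction hpath using Relation.ReflTransGen.head_induction_on with
    | refl => exact hi₀
    | @head i j hij _ ih =>
      by_cases hi : i = i₀
      · rwa [hi]
      · exact .head (by rw [pathExtension_inr_inr]; exact hedge i j hi hij) ih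

end PrimitiveExtension

section BoxExtension

variable {G : Type*} [Group G] {k n : Type*} [Fintype k] [DecidableEq k] [Nonempty k]
  [Fintype n] [DecidableEq n] {A : Matrix n n (ZG G)} {C : Matrix n n (ZG G)[X]} {i₀ : n} {q : ℕ}
  {y : k → (ZG G)[X]} {Q : Matrix k k (ZG G)[X]}

theorem gprimitive_box_pathExtension (hA : GPrimitive A) (hi₀ : ∀ j, ∃ l, l ≠ i₀ ∧ A l j ≠ 0)
    (hC : IsRowExpansion A i₀ q C) (hloop : C i₀ i₀ ≠ 0) (hy0 : ∀ a, (y a).coeff 0 = 0)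
    (hy : ∀ a t j, PowerSeries.coeff t (pathSeries C i₀ (y a) j) ∈ nonnegCone G) {N r : ℕ}
    (hqN : q ≤ N) (hyN : ∀ a e, N - q < e → (y a).coeff e = 0)
    (hQN : ∀ a b e, N - q < e → (Q a b).coeff e = 0)
    (hN : ∀ a j, PowerSeries.coeff N (pathSeries C i₀ (y a) j) ≠ 0) (hrN : r ≤ N - q)
    (hpos : ∀ a b t, r ≤ t →
      StrictlyPos ((Q a b).coeff t + PowerSeries.coeff t (pathSeries C i₀ (y a) i₀)))
    (hB : EntriesIn (tPolyOver (nonnegCone G)) (pathExtension Q C i₀ q N y)) :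
    GPrimitive (box (pathExtension Q C i₀ q N y)) := by
  obtain ⟨a₀⟩ := ‹Nonempty k›
  have hCP : EntriesIn (polyOver (nonnegCone G)) C := fun i j =>
    pathExtension_inr_inr (Q := Q) (C := C) (i₀ := i₀) (q := q) (N := N) (y := y) i j ▸
      hB.of_tPolyOver (.inr i) (.inr j)
  have htop : ∀ a j, (pathExtension Q C i₀ q N y (.inl a) j).coeff (N + 1) ≠ 0 := fun a j => by
    rw [coeff_pathExtension_inl_of_lt hC hyN hQN a j N.lt_succ_self]
    obtain ⟨l, hl, hlj⟩ := hi₀ (j.elim (fun _ => i₀) id)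
    exact coeff_truncPaths_mul_ne_zero hC hCP hy0 hy hl hlj (hN a l)
  have hdeg : polyDegree (pathExtension Q C i₀ q N y) = N + 1 :=
    le_antisymm (polyDegree_le_iff.2 ⟨by omega, fun i j _ he =>
        coeff_pathExtension_of_lt hC hqN hyN hQN i j he⟩)
      (not_lt.1 fun h => htop a₀ (.inl a₀) (coeff_eq_zero_of_polyDegree_lt h _ _))
  have hloops : ∀ e, r ≤ e → e ≤ N - q + 1 →
      StrictlyPos ((pathExtension Q C i₀ q N y (.inl a₀) (.inl a₀)).coeff e) := fun e hre he => by
    rw [coeff_pathExtension_inl_inl hC a₀ a₀ he]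
    exact hpos a₀ a₀ e hre
  refine gprimitive_box hB (Nat.coprime_self_add_right.2 (Nat.coprime_one_right r))
    (hloops r le_rfl (by omega)) (hloops (r + 1) (by omega) (by omega))
    (reflTransGen_pathExtension hA hC hloop fun b h => ?_) fun j => hdeg ▸ htop a₀ j
  exact htop b (.inl a₀) (by rw [h, coeff_zero])

theorem exists_gprimitive_box_pathExtension (hA : GPrimitive A)
    (hi₀ : ∀ j, ∃ l, l ≠ i₀ ∧ A l j ≠ 0) (hC : IsRowExpansion A i₀ q C)
    (hCP : EntriesIn (tPolyOver (nonnegCone G)) C) (hloop : C i₀ i₀ ≠ 0)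
    (hy0 : ∀ a, (y a).coeff 0 = 0)
    (hy : ∀ a t j, PowerSeries.coeff t (pathSeries C i₀ (y a) j) ∈ nonnegCone G) {T : ℕ}
    (hT : ∀ a t j, T < t → PowerSeries.coeff t (pathSeries C i₀ (y a) j) ≠ 0) {r : ℕ} (hr : r ≠ 0)
    (hQr : ∀ a b, ∀ m < r, (Q a b).coeff m = 0)
    (hpos : ∀ a b t, r ≤ t →
      StrictlyPos ((Q a b).coeff t + PowerSeries.coeff t (pathSeries C i₀ (y a) i₀))) :
    ∃ N, EntriesIn (tPolyOver (nonnegCone G)) (pathExtension Q C i₀ q N y) ∧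
      GPrimitive (box (pathExtension Q C i₀ q N y)) := by
  let N := q + (r + T + 1 + polyDegree Q + ∑ a, (y a).natDegree)
  have hyN : ∀ a e, N - q < e → (y a).coeff e = 0 := fun a e he => by
    have ha : (y a).natDegree ≤ ∑ a, (y a).natDegree :=
      Finset.single_le_sum_of_canonicallyOrdered (f := fun a => (y a).natDegree) (Finset.mem_univ a)
    exact coeff_eq_zero_of_natDegree_lt (by omega)
  have hQN : ∀ a b e, N - q < e → (Q a b).coeff e = 0 := fun a b e he =>
    coeff_eq_zero_of_polyDegree_lt (by omega) a b
  have hB : EntriesIn (tPolyOver (nonnegCone G)) (pathExtension Q C i₀ q N y) := by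
    refine .pathExtension hC hCP hy0 hyN hy (fun a b => hQr a b 0 (Nat.pos_of_ne_zero hr)) hQN
      fun a b e => ?_
    rcases le_or_gt r e with he | he
    · exact fun g => (hpos a b e he g).le
    · rw [hQr a b e he, zero_add]
      exact hy a e i₀
  exact ⟨N, hB, gprimitive_box_pathExtension hA hi₀ hC hloop hy0 hy (by omega) hyN hQN
    (fun a j => hT a N j (by omega)) (by omega) hpos hB⟩

end BoxExtension

section Domination

variable {G : Type*}

theorem StrictlyPos.of_half_le {x y : ZG G} (hx : StrictlyPos x)
    (h : ∀ g, 1 / 2 * (x.coeff g : ℝ) ≤ y.coeff g) : StrictlyPos y := fun g => by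
  have hxg : (0 : ℝ) < x.coeff g := Int.cast_pos.2 (hx g)
  exact Int.cast_pos.1 ((mul_pos one_half_pos hxg).trans_le (h g))

theorem strictlyPos_add_of_half_le {b c : ℝ} {x y z : ZG G} (hx : ∀ g, c ≤ (x.coeff g : ℝ))
    (hxy : ∀ g, 1 / 2 * (x.coeff g : ℝ) ≤ y.coeff g) (hz : ∀ g, |(z.coeff g : ℝ)| ≤ b)
    (hbc : b < 1 / 2 * c) : StrictlyPos (z + y) := fun g => by
  rw [MonoidAlgebra.coeff_add, Finsupp.add_apply]
  have hsum : (0 : ℝ) < z.coeff g + y.coeff g := by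
    linarith [hx g, hxy g, neg_le_of_abs_le (hz g)]
  exact_mod_cast hsum

variable [Group G]

theorem mem_nonnegCone_of_half_le {x y : ZG G} (hx : x ∈ nonnegCone G)
    (h : ∀ g, 1 / 2 * (x.coeff g : ℝ) ≤ y.coeff g) : y ∈ nonnegCone G := fun g => by
  have hxg : (0 : ℝ) ≤ x.coeff g := Int.cast_nonneg (hx g)
  exact Int.cast_nonneg_iff.1 ((mul_nonneg one_half_pos.le hxg).trans (h g))

variable {n : Type*} [Fintype n] [DecidableEq n] {C : Matrix n n (ZG G)[X]} {i₀ : n} {γ : ℝ}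
  {m₀ : ℕ}

theorem exists_forall_strictlyPos_pathSum (hC : EntriesIn (polyOver (nonnegCone G)) C) (hγ : 0 < γ)
    (hz : ∀ m, m₀ ≤ m → ∀ g, γ ^ m ≤ ((pathSum C i₀ m i₀).coeff g : ℝ))
    (hne : ∀ j, ∃ t, pathSum C i₀ t j ≠ 0) :
    ∃ T, ∀ t, T ≤ t → ∀ j, StrictlyPos (pathSum C i₀ t j) := by
  choose t₀ ht₀ using hne
  refine ⟨m₀ + ∑ j, t₀ j, fun t ht j g => ?_⟩
  have hj : t₀ j ≤ ∑ j, t₀ j := Finset.single_le_sum_of_canonicallyOrdered (Finset.mem_univ j)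
  have hle := pow_mul_aug_le_coeff_pathSum hC (hz (t - t₀ j) (by omega)) (t₀ j) j g
  rw [Nat.sub_add_cancel (by omega)] at hle
  have haug : (0 : ℝ) < aug (pathSum C i₀ (t₀ j) j) :=
    Int.cast_pos.2 (aug_pos (pathSum_mem hC i₀ _ j) (ht₀ j))
  exact Int.cast_pos.1 ((mul_pos (pow_pos hγ _) haug).trans_le hle)

theorem strictlyPos_coeff_pathSeries_single {T : ℕ}
    (hT : ∀ t, T ≤ t → ∀ j, StrictlyPos (pathSum C i₀ t j)) (c : ℕ) (g : G) (j : n) {t : ℕ}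
    (ht : T + c < t) : StrictlyPos (PowerSeries.coeff t (pathSeries C i₀
      (monomial (c + 1) (MonoidAlgebra.single g 1)) j)) := by
  rw [coeff_pathSeries_monomial, if_pos (by omega)]
  exact (hT _ (by omega) j).mul_left (single_mem_nonnegCone g zero_le_one)
    (MonoidAlgebra.single_ne_zero.2 one_ne_zero)

theorem pow_le_coeff_pathSeries_single
    (hz : ∀ m, m₀ ≤ m → ∀ g, γ ^ m ≤ ((pathSum C i₀ m i₀).coeff g : ℝ)) (c : ℕ) (g : G) {t : ℕ}
    (ht : m₀ + c < t) (h : G) : γ ^ (t - (c + 1)) ≤ ((PowerSeries.coeff t (pathSeries C i₀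
      (monomial (c + 1) (MonoidAlgebra.single g 1)) i₀)).coeff h : ℝ) := by
  rw [coeff_pathSeries_monomial, if_pos (by omega), MonoidAlgebra.coeff_single_mul_apply, one_mul]
  exact hz _ (by omega) _

variable {k : Type*} [Fintype k] [DecidableEq k] [Nonempty k] {A : Matrix n n (ZG G)} {β : ℝ}
  {q r : ℕ} {s : k → ℕ} {Q : Matrix k k (ZG G)[X]}

theorem exists_gprimitive_box_pathExtension_mulVec (hA : GPrimitive A)
    (hi₀ : ∀ j, ∃ l, l ≠ i₀ ∧ A l j ≠ 0) (hC : IsRowExpansion A i₀ q C)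
    (hCP : EntriesIn (tPolyOver (nonnegCone G)) C) (hβ : 0 < β) (hγ : 1 ≤ γ) (hβγ : β < γ)
    (hm₀ : m₀ ≠ 0) (hmq : m₀ ≤ q)
    (hz : ∀ m, m₀ ≤ m → ∀ g, γ ^ m ≤ ((pathSum C i₀ m i₀).coeff g : ℝ)) (hsq : ∀ a, s a ≤ q)
    (g : k → G) (hr : q + m₀ < r)
    (hsmall : Fintype.card k * (γ ^ q * ((β / γ) ^ r / (1 - β / γ))) ≤ 1 / 2)
    (hlarge : ∀ t, r ≤ t → ∀ a, β ^ t < 1 / 2 * γ ^ (t - (s a + 1)))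
    (hQ : ∀ i j m g, |(((Q i j).coeff m).coeff g : ℝ)| ≤ β ^ m)
    (hQr : ∀ i j, ∀ m < r, (Q i j).coeff m = 0) {y : k → (ZG G)[X]}
    (hy : y = (1 - Q).mulVec fun a => monomial (s a + 1) (MonoidAlgebra.single (g a) 1)) :
    ∃ N, EntriesIn (tPolyOver (nonnegCone G)) (truncPaths C i₀ q N y) ∧
      EntriesIn (tPolyOver (nonnegCone G)) (pathExtension Q C i₀ q N y) ∧
        GPrimitive (box (pathExtension Q C i₀ q N y)) := by
  have hγ0 : 0 < γ := one_pos.trans_le hγ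
  have hCP' := hCP.of_tPolyOver
  have hhalf := half_le_coeff_pathSeries hCP' hβ hγ hβγ hz hr hsmall hsq g hQ hQr
  rw [← hy] at hhalf
  have hmem : ∀ a t j, PowerSeries.coeff t (pathSeries C i₀ (y a) j) ∈ nonnegCone G := fun a t j =>
    mem_nonnegCone_of_half_le (coeff_pathSeries_single_mem hCP' (s a) (g a) j t) (hhalf a j t)
  obtain ⟨T, hT⟩ := exists_forall_strictlyPos_pathSum hCP' hγ0 hz
    (hC.exists_pathSum_ne_zero hCP' hA hi₀)
  have hne : ∀ a t j, T + q < t → PowerSeries.coeff t (pathSeries C i₀ (y a) j) ≠ 0 :=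
    fun a t j ht => ((strictlyPos_coeff_pathSeries_single hT (s a) (g a) j
      ((Nat.add_le_add_left (hsq a) T).trans_lt ht)).of_half_le (hhalf a j t)).ne_zero
  have hpos : ∀ a b t, r ≤ t →
      StrictlyPos ((Q a b).coeff t + PowerSeries.coeff t (pathSeries C i₀ (y a) i₀)) :=
    fun a b t ht => strictlyPos_add_of_half_le
      (pow_le_coeff_pathSeries_single hz (s a) (g a) (by have := hsq a; omega))
      (hhalf a i₀ t) (hQ a b t) (hlarge t ht a)
  have hloop : C i₀ i₀ ≠ 0 := hC.loop_ne_zero hm₀ hmq fun h0 => by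
    have hpow := hz m₀ le_rfl 1
    rw [h0, MonoidAlgebra.coeff_zero, Finsupp.zero_apply, Int.cast_zero] at hpow
    exact (pow_pos hγ0 m₀).not_ge hpow
  have hy0 : ∀ a, (y a).coeff 0 = 0 := fun a => by
    rw [hy, Matrix.mulVec, dotProduct, finsetSum_coeff]
    exact Finset.sum_eq_zero fun b _ => by
      rw [mul_coeff_zero, coeff_monomial_of_ne _ (Nat.succ_ne_zero _).symm, mul_zero]
  obtain ⟨N, hB, hprim⟩ := exists_gprimitive_box_pathExtension hA hi₀ hC hCP hloop hy0 hmem hne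
    (by omega) hQr hpos
  exact ⟨N, .truncPaths hy0 hmem, hB, hprim⟩

end Domination

section Extension

variable {G : Type*} [Group G] {k n : Type} [Fintype k] [DecidableEq k] [Fintype n] [DecidableEq n]
  {A : Matrix n n (ZG G)} {i₀ : n}

theorem exists_extension [Nonempty k] (hA : GPrimitive A) (hi₀ : ∀ j, ∃ l, l ≠ i₀ ∧ A l j ≠ 0)
    {β γ : ℝ} (hβ : 0 < β) (hγ : 1 ≤ γ) (hβγ : β < γ) {m₀ : ℕ} (hm₀ : m₀ ≠ 0)
    (hAγ : ∀ m, m₀ ≤ m → ∀ g, γ ^ m ≤ (((A ^ m) i₀ i₀).coeff g : ℝ)) {s : k → ℕ}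
    (hs : Function.Injective s) (hms : ∀ a, 2 * m₀ ≤ s a) {g : k → G}
    (hg : ∀ a, 0 < (firstPass A i₀ (s a) i₀).coeff (g a)) {q : ℕ} (hsq : ∀ a, s a ≤ q) {r : ℕ}
    (hr : q + m₀ < r) (hsmall : Fintype.card k * (γ ^ q * ((β / γ) ^ r / (1 - β / γ))) ≤ 1 / 2)
    (hlarge : ∀ t, r ≤ t → ∀ a, β ^ t < 1 / 2 * γ ^ (t - (s a + 1))) {P Q : Matrix k k (ZG G)[X]}
    (hP : P * (1 - Q) = 1) (hQ : ∀ i j m g, |(((Q i j).coeff m).coeff g : ℝ)| ≤ β ^ m)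
    (hQr : ∀ i j, ∀ m < r, (Q i j).coeff m = 0) :
    ∃ B : Matrix (k ⊕ n) (k ⊕ n) (ZG G)[X],
      ElEquiv (Matrix.fromBlocks (1 - Q) 0 0 (1 - tMul A)) (1 - B) ∧ OverTPos B ∧
        GPrimitive (box B) ∧
          (Q.map augPoly = 0 → SSE {x : ℤ | 0 ≤ x} ((box B).map aug) (A.map aug)) := by
  let x : k → ZG G := fun a => MonoidAlgebra.single (g a) 1
  have hmq : 2 * m₀ ≤ q := let ⟨a⟩ := ‹Nonempty k›; (hms a).trans (hsq a)
  have hC : IsRowExpansion A i₀ q (deleteLoops A i₀ q s x) := isRowExpansion_deleteLoops hsq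
  have hCP : EntriesIn (tPolyOver (nonnegCone G)) (deleteLoops A i₀ q s x) :=
    .deleteLoops hA.1 hs hsq fun a =>
      sub_single_mem_nonnegCone (firstPass_mem (P := nonnegCone G) hA.1 i₀ (s a) i₀) (hg a)
  have hz : ∀ m, m₀ ≤ m → ∀ g,
      γ ^ m ≤ ((pathSum (deleteLoops A i₀ q s x) i₀ m i₀).coeff g : ℝ) := fun m hm =>
    pow_le_coeff_pathSum hCP.of_tPolyOver (hβ.trans hβγ) (Nat.pos_of_ne_zero hm₀)
      (fun m hm hm2 g => hC.pathSum_eq_pow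
        (fun e he => coeff_deleteLoops_of_lt hms hmq he) hmq hm2 ▸ hAγ m hm g) hm
  obtain ⟨N, hρ, hB, hprim⟩ := exists_gprimitive_box_pathExtension_mulVec hA hi₀ hC hCP hβ hγ hβγ
    hm₀ (by omega) hz hsq g hr hsmall hlarge hQ hQr rfl
  exact ⟨_, .pathExtension hP s x, hB, hprim, fun hQ0 =>
    sse_map_box_pathExtension (P := nonnegCone G) (P' := Subsemiring.nonneg ℤ)
      (fun _ => aug_nonneg) rfl hQ0 hA.1 (fun a => single_mem_nonnegCone (g a) zero_le_one)
      hCP hρ hB⟩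

theorem GPrimitive.submatrix {m n : Type*} [Fintype m] [DecidableEq m] [Fintype n] [DecidableEq n]
    {A : Matrix n n (ZG G)} (hA : GPrimitive A) (e : m ≃ n) : GPrimitive (A.submatrix e e) := by
  obtain ⟨hnonneg, p, hp, hpos⟩ := hA
  have hpow : A.submatrix e e ^ p = (A ^ p).submatrix e e :=
    (map_pow (Matrix.reindexRingEquiv (ZG G) e.symm) A p).symm
  exact ⟨fun i j => hnonneg _ _, p, hp, fun i j => hpow ▸ hpos _ _⟩

theorem exists_box_eq_submatrix_of_isEmpty [IsEmpty k] {B : Matrix (k ⊕ n) (k ⊕ n) (ZG G)[X]}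
    (hB : B = Matrix.fromBlocks 0 0 0 (tMul A)) :
    ∃ e : Fin (polyDegree B) × (k ⊕ n) ≃ n, box B = A.submatrix e e := by
  have hdeg : polyDegree B = 1 := by
    refine le_antisymm (polyDegree_le_iff.2 ⟨le_rfl, fun i j e he => ?_⟩) (le_max_left _ _)
    rcases i with i | i
    · exact isEmptyElim i
    rcases j with j | j
    · exact isEmptyElim j
    rw [hB]
    exact coeff_monomial_of_ne _ he.ne'
  rw [box_eq_polyCompanion, hdeg]
  refine ⟨(Equiv.uniqueProd (k ⊕ n) (Fin 1)).trans (Equiv.emptySum k n), ?_⟩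
  ext1 ⟨a, i⟩ ⟨b, j⟩
  rcases i with i | i
  · exact isEmptyElim i
  rcases j with j | j
  · exact isEmptyElim j
  simp [hB, polyCompanion, blockCompanion, coeffMatrix_apply, tMul]

theorem exists_extension_of_isEmpty [IsEmpty k] (hA : GPrimitive A) (Q : Matrix k k (ZG G)[X]) :
    ∃ B : Matrix (k ⊕ n) (k ⊕ n) (ZG G)[X],
      ElEquiv (Matrix.fromBlocks (1 - Q) 0 0 (1 - tMul A)) (1 - B) ∧ OverTPos B ∧
        GPrimitive (box B) ∧ SSE {x : ℤ | 0 ≤ x} ((box B).map aug) (A.map aug) := by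
  obtain ⟨e, he⟩ := exists_box_eq_submatrix_of_isEmpty (k := k) (A := A) rfl
  refine ⟨Matrix.fromBlocks 0 0 0 (tMul A), ?_, ?_, he ▸ hA.submatrix e, ?_⟩
  · refine .of_mul_mul (one_mem _) (one_mem _) ?_
    rw [Matrix.one_mul, Matrix.mul_one]
    ext1 (i | i) (j | j)
    · exact isEmptyElim i
    · exact isEmptyElim i
    · exact isEmptyElim j
    · simp [Matrix.one_apply]
  · exact EntriesIn.fromBlocks (.zero _) (.zero _) (.zero _) fun i j =>
      monomial_mem_tPolyOver (P := nonnegCone G) one_ne_zero (hA.1 i j)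
  · rw [he]
    exact (SSE.submatrix (P := Subsemiring.nonneg ℤ) (M := A.map aug)
      (fun i j => aug_nonneg (hA.1 i j)) e.injective
      fun i j hj => absurd (e.surjective j) hj).symm

end Extension

section Threshold

theorem exists_threshold {β γ : ℝ} (hβ : 1 < β) (hβγ : β < γ) (k q : ℕ) :
    ∃ r₀ : ℕ, ∀ r, r₀ ≤ r → (k : ℝ) * (γ ^ q * ((β / γ) ^ r / (1 - β / γ))) ≤ 1 / 2 ∧
      ∀ d, d ≤ q → β ^ r < 1 / 2 * γ ^ (r - (d + 1)) := by
  have hβ0 : 0 < β := one_pos.trans hβ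
  have hγ0 : 0 < γ := hβ0.trans hβγ
  have hsmall : Filter.Tendsto (fun r : ℕ => (k : ℝ) * (γ ^ q * ((β / γ) ^ r / (1 - β / γ))))
      Filter.atTop (nhds (k * (γ ^ q * (0 / (1 - β / γ))))) :=
    (((tendsto_pow_atTop_nhds_zero_of_lt_one (by positivity)
      ((div_lt_one hγ0).2 hβγ)).div_const _).const_mul _).const_mul _
  rw [zero_div, mul_zero, mul_zero] at hsmall
  have hlarge := (tendsto_pow_atTop_atTop_of_one_lt ((one_lt_div hβ0).2 hβγ)).eventually_gt_atTop
    (2 * γ ^ (q + 1))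
  obtain ⟨r₀, hr₀⟩ := Filter.eventually_atTop.1
    ((hsmall.eventually_le_const one_half_pos).and hlarge)
  refine ⟨r₀, fun r hr => ⟨(hr₀ r hr).1, fun d hd => ?_⟩⟩
  have hratio : 2 * γ ^ (q + 1) * β ^ r < γ ^ r := by
    rw [← lt_div_iff₀ (by positivity), ← div_pow]
    exact (hr₀ r hr).2
  have hγr : γ ^ r ≤ γ ^ (q + 1) * γ ^ (r - (d + 1)) := by
    rw [← pow_add]
    exact pow_le_pow_right₀ (hβ.trans hβγ).le (by omega)
  refine lt_of_mul_lt_mul_left (a := γ ^ (q + 1)) ?_ (by positivity)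
  linarith

end Threshold

end GExt

end

open GExt in
theorem proposition5p4 {G : Type*} [Group G] [Finite G]
    (n : ℕ) (hn : 1 < n) (A : Matrix (Fin n) (Fin n) (ZG G)) (hA : GPrimitive A)
    (β : ℝ) (hβ : 1 < β) (hβA : β < specRadius A) (k : ℕ) :
    ∃ r₀ : ℕ, 0 < r₀ ∧ ∀ r : ℕ, r₀ ≤ r → ∀ Q : Matrix (Fin k) (Fin k) (ZG G)[X],
      IsUnit (1 - Q) →
      (∀ i j s g, |((((Q i j).coeff s).coeff g : ℤ) : ℝ)| ≤ β ^ s) →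
      (∀ i j, ∀ s < r, (Q i j).coeff s = 0) →
      ∃ B : Matrix (Fin k ⊕ Fin n) (Fin k ⊕ Fin n) (ZG G)[X],
        ElEquiv (Matrix.fromBlocks (1 - Q) 0 0 (1 - tMul A)) (1 - B) ∧
        OverTPos B ∧
        GPrimitive (box B) ∧
        (Q.map augPoly = 0 → SSE {x : ℤ | 0 ≤ x} ((box B).map aug) (A.map aug)) := by
  have := Fintype.ofFinite G
  have : Nontrivial (Fin n) := Fin.nontrivial_iff_two_le.2 hn
  obtain ⟨i₀, hi₀⟩ := hA.exists_forall_exists_ne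
  rcases Nat.eq_zero_or_pos k with rfl | hk
  · refine ⟨1, one_pos, fun r _ Q _ _ _ => ?_⟩
    obtain ⟨B, hEl, hB, hprim, hSSE⟩ := exists_extension_of_isEmpty hA Q
    exact ⟨B, hEl, hB, hprim, fun _ => hSSE⟩
  · have : Nonempty (Fin k) := ⟨⟨0, hk⟩⟩
    obtain ⟨γ, hβγ, m₀, hm₀⟩ := hA.exists_growth (one_pos.trans hβ) hβA
    obtain ⟨s, g, hs, hms, hg⟩ := hA.exists_loops hi₀ k (2 * (m₀ + 1))
    have hsq : ∀ a, s a ≤ ∑ a, s a := fun a =>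
      Finset.single_le_sum_of_canonicallyOrdered (Finset.mem_univ a)
    obtain ⟨r₀, hr₀⟩ := exists_threshold hβ hβγ k (∑ a, s a)
    refine ⟨r₀ + ∑ a, s a + (m₀ + 1) + 1, by omega, fun r hr Q hQu hQ hQr => ?_⟩
    obtain ⟨P, hP⟩ := hQu.exists_left_inv
    exact exists_extension hA hi₀ (one_pos.trans hβ) (hβ.trans hβγ).le hβγ m₀.succ_ne_zero
      (fun m hm g => hm₀ m (by omega) i₀ i₀ g) hs hms hg hsq (by omega)
      (by simpa only [Fintype.card_fin] using (hr₀ r (by omega)).1)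
      (fun t ht a => (hr₀ t (by omega)).2 _ (hsq a)) hP hQ hQr
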